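/- Let $n\ge 1$, let $\mathcal C$ be an additive category and let $\Sigma\colon\mathcal C\to\mathcal C$ be an automorphism (it is enough that $\Sigma$ is an auto-equivalence). Let $\mathbb E_\Sigma=\mathcal C(-,\Sigma-)\colon \mathcal C^{\mathrm{op}}\times\mathcal C\to \mathrm{Ab}$, so that for $\delta\in\mathbb E_\Sigma(C,A)=\mathcal C(C,\Sigma A)$, $a\colon A\to A'$, $c\colon C'\to C$ one has $a_*\delta=(\Sigma a)\circ\delta$ and $c^*\delta=\delta\circ c$. Let $\mathfrak s$ be an exact realization of $\mathbb E_\Sigma$ such that $(\mathcal C,\mathbb E_\Sigma,\mathfrak s)$ is an $n$-exangulated category, and let $\square_{\mathfrak s}$ be the class of all $(n+2)$-$\Sigma$-sequences $$X^0\xrightarrow{d^0}X^1\xrightarrow{d^1}\cdots\xrightarrow{d^n}X^{n+1}\xrightarrow{\delta}\Sigma X^0$$ for which $\langle X^\bullet,\delta\rangle$ is an $\mathfrak s$-distinguished $n$-exangle, i.e. $X^\bullet$ is a complex and $\mathfrak s(\delta)=[X^\bullet]$. Then $(\mathcal C,\Sigma,\square_{\mathfrak s})$ is an $(n+2)$-angulated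 category. Here the terms have the following meaning. *$n$-exangulated category* $(\mathcal C,\mathbb E,\mathfrak s)$: $\mathbb E$ is a biadditive functor $\mathcal C^{\mathrm{op}}\times\mathcal C\to\mathrm{Ab}$, and $\mathfrak s$ assigns to each $\delta\in\mathbb E(C,A)$ a homotopy equivalence class $[X^\bullet]$ of complexes $X^0\to\cdots\to X^{n+1}$ with $X^0=A$, $X^{n+1}=C$ (morphisms being the identity on $A$ and $C$), such that the following hold. Whenever $\mathfrak s(\delta)=[X^\bullet]$ and $\mathfrak s(\rho)=[Y^\bullet]$, every $(a,c)$ with $a_*\delta=c^*\rho$ lifts to a morphism $(a,f^1,\dots,f^n,c)\colon X^\bullet\to Y^\bullet$. If $\mathfrak s(\delta)=[X^\bullet]$, then for all $Q\in\mathcal C$ the sequences $\mathcal C(Q,X^0)\to\cdots\to\mathcal C(Q,X^{n+1})\to\mathbb E(Q,X^0)$ and $\mathcal C(X^{n+1},Q)\to\cdots\to\mathcal C(X^0,Q)\to\mathbb E(X^{n+1},Q)$ are exact, where the last maps are $g\mapsto g^*\delta$ and $g\mapsto g_*\delta$. Moreover $\mathfrak s({}_A0_0)=[A\xrightarrow{\mathrm{id}}A\to0\to\cdots\to0]$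 and $\mathfrak s({}_00_A)=[0\to\cdots\to0\to A\xrightarrow{\mathrm{id}}A]$. The first morphisms $d_X^0$ of complexes $X^\bullet$ realizing some extension are closed under composition, and so are the last morphisms $d_X^n$. Finally, for $\rho\in\mathbb E(D,A)$, $c\colon C\to D$, $\mathfrak s(c^*\rho)=[X^\bullet]$, $\mathfrak s(\rho)=[Y^\bullet]$, the pair $(\mathrm{id}_A,c)$ has a lift $f$ whose mapping cone $X^1\to X^2\oplus Y^1\to\cdots\to X^{n+1}\oplus Y^n\to Y^{n+1}$ (with differentials $\left[\begin{smallmatrix}-d_X^1\\f^1\end{smallmatrix}\right]$, $\left[\begin{smallmatrix}-d_X^{i+1}&0\\f^{i+1}&d_Y^i\end{smallmatrix}\right]$, $[f^{n+1}\ d_Y^n]$) realizes $(d_X^0)_*\rho$; and dually, for $\delta\in\mathbb E(C,A)$, $a\colon A\to B$, $\mathfrak s(\delta)=[X^\bullet]$, $\mathfrak s(a_*\delta)=[Y^\bullet]$, the pair $(a,\mathrm{id}_C)$ has a lift whose mapping cocone realizes $(d_Y^n)^*\delta$. *$(n+2)$-angulated category* $(\mathcal C,\Sigma,\square)$ (Geiss–Keller–Oppermann):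 $\square$ is a class of $(n+2)$-$\Sigma$-sequences, closed under isomorphisms, direct sums and direct summands, such that: (1) $A\xrightarrow{\mathrm{id}}A\to0\to\cdots\to0\to\Sigma A$ is in $\square$ for all $A$; (2) every morphism of $\mathcal C$ is the first morphism of a member of $\square$; (3) a sequence is in $\square$ if and only if its left rotation $X^1\xrightarrow{d^1}\cdots\to X^{n+1}\xrightarrow{\delta}\Sigma X^0\xrightarrow{(-1)^n\Sigma d^0}\Sigma X^1$ is; (4) for $X,Y\in\square$, every pair $(f^0,f^1)$ with $f^1d_X^0=d_Y^0f^0$ extends to a morphism $f\colon X\to Y$ of $(n+2)$-$\Sigma$-sequences; (5) in (4), $f$ can be chosen such that its cone $X^1\oplus Y^0\to X^2\oplus Y^1\to\cdots\to X^{n+1}\oplus Y^n\to\Sigma X^0\oplus Y^{n+1}\to\Sigma X^1\oplus\Sigma Y^0$ (with differentials $\left[\begin{smallmatrix}-d_X^{i+1}&0\\f^{i+1}&d_Y^i\end{smallmatrix}\right]$, $\left[\begin{smallmatrix}-\delta_X&0\\f^{n+1}&d_Y^n\end{smallmatrix}\right]$, $\left[\begin{smallmatrix}-\Sigma d_X^0&0\\\Sigma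 f^0&\delta_Y\end{smallmatrix}\right]$) is in $\square$. -/

import Mathlib

open CategoryTheory CategoryTheory.Limits Opposite
open scoped ZeroObject

universe w v u

namespace NExang

/-! ### Finite sequences of morphisms -/

/-- A sequence `X⁰ ⟶ X¹ ⟶ ⋯ ⟶ Xᵐ` of morphisms (no condition on composites), extended by zero
objects in the degrees above `m`. -/
structure Seq (𝒞 : Type u) [Category.{v} 𝒞] (m : ℕ) where
  obj (i : ℕ) : 𝒞
  d (i : ℕ) : obj i ⟶ obj (i + 1)
  isZero (i : ℕ) (hi : m < i) : IsZero (obj i)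

namespace Seq

section Basic

variable {𝒞 : Type u} [Category.{v} 𝒞] {m : ℕ}

/-- Morphisms of sequences: commutative ladders. -/
@[ext]
structure Hom (X Y : Seq 𝒞 m) where
  app (i : ℕ) : X.obj i ⟶ Y.obj i
  comm (i : ℕ) : X.d i ≫ app (i + 1) = app i ≫ Y.d i

instance : Category (Seq 𝒞 m) where
  Hom := Hom
  id X := { app := fun i => 𝟙 (X.obj i), comm := fun i => by simp }
  comp f g :=
    { app := fun i => f.app i ≫ g.app i
      comm := fun i => by
        rw [← Category.assoc, f.comm i, Category.assoc, g.comm i, Category.assoc] }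
  id_comp f := by apply Hom.ext; funext i; exact Category.id_comp _
  comp_id f := by apply Hom.ext; funext i; exact Category.comp_id _
  assoc f g h := by apply Hom.ext; funext i; exact Category.assoc _ _ _

/-- The component in degree `i` of a morphism of sequences. -/
def app {X Y : Seq 𝒞 m} (f : X ⟶ Y) (i : ℕ) : X.obj i ⟶ Y.obj i :=
  Hom.app f i

lemma app_id (X : Seq 𝒞 m) (i : ℕ) : app (𝟙 X) i = 𝟙 (X.obj i) := rfl

lemma app_comp {X Y Z : Seq 𝒞 m} (f : X ⟶ Y) (g : Y ⟶ Z) (i : ℕ) :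
    app (f ≫ g) i = app f i ≫ app g i := rfl

lemma app_comm {X Y : Seq 𝒞 m} (f : X ⟶ Y) (i : ℕ) :
    X.d i ≫ app f (i + 1) = app f i ≫ Y.d i := Hom.comm f i

end Basic

section Zero

variable {𝒞 : Type u} [Category.{v} 𝒞] [Preadditive 𝒞]

section Snoc

variable [HasZeroObject 𝒞]

/-- The terms of `K⁰ ⟶ ⋯ ⟶ Kᵐ ⟶ Z`. -/
noncomputable def snocObj (K : ℕ → 𝒞) (m : ℕ) (Z : 𝒞) (i : ℕ) : 𝒞 :=
  if i ≤ m then K i else if i = m + 1 then Z else 0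

set_option linter.unusedSectionVars false in
lemma snocObj_of_le (K : ℕ → 𝒞) (m : ℕ) (Z : 𝒞) (i : ℕ) (hi : i ≤ m) :
    snocObj K m Z i = K i := if_pos hi

set_option linter.unusedSectionVars false in
lemma snocObj_last (K : ℕ → 𝒞) (m : ℕ) (Z : 𝒞) : snocObj K m Z (m + 1) = Z := by
  simp [snocObj]

/-- The sequence `K⁰ ⟶ ⋯ ⟶ Kᵐ ⟶ Z` whose last morphism is `f` (the objects `Kⁱ` for `i > m` are
not used). -/
noncomputable def snoc (K : ℕ → 𝒞) (dK : ∀ i, K i ⟶ K (i + 1)) (m : ℕ) {Z : 𝒞} (f : K m ⟶ Z) :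
    Seq 𝒞 (m + 1) where
  obj i := snocObj K m Z i
  d i :=
    if h : i < m then
      eqToHom (snocObj_of_le K m Z i (by omega)) ≫ dK i ≫
        eqToHom (snocObj_of_le K m Z (i + 1) h).symm
    else if h' : i = m then
      eqToHom (by subst h'; exact snocObj_of_le K i Z i le_rfl) ≫ f ≫
        eqToHom (by subst h'; exact (snocObj_last K i Z).symm)
    else 0
  isZero i hi := by
    have h₁ : ¬ i ≤ m := by omega
    have h₂ : ¬ i = m + 1 := by omega
    rw [snocObj, if_neg h₁, if_neg h₂]
    exact isZero_zero 𝒞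

variable (K : ℕ → 𝒞) (dK : ∀ i, K i ⟶ K (i + 1)) (m : ℕ) {Z : 𝒞} (f : K m ⟶ Z)

/-- The terms of degree at most `m` of `K⁰ ⟶ ⋯ ⟶ Kᵐ ⟶ Z`. -/
noncomputable def snocIso (i : ℕ) (hi : i ≤ m) : (snoc K dK m f).obj i ≅ K i :=
  eqToIso (snocObj_of_le K m Z i hi)

/-- The last term of `K⁰ ⟶ ⋯ ⟶ Kᵐ ⟶ Z`. -/
noncomputable def snocLastIso : (snoc K dK m f).obj (m + 1) ≅ Z :=
  eqToIso (snocObj_last K m Z)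

lemma snoc_d (i : ℕ) (hi : i < m) :
    (snoc K dK m f).d i ≫ (snocIso K dK m f (i + 1) hi).hom =
      (snocIso K dK m f i hi.le).hom ≫ dK i := by
  simp [snoc, snocIso, hi]

lemma snoc_d_last :
    (snoc K dK m f).d m ≫ (snocLastIso K dK m f).hom = (snocIso K dK m f m le_rfl).hom ≫ f := by
  simp [snoc, snocIso, snocLastIso]

end Snoc

variable {n : ℕ}

/-- The condition `dⁱ⁺¹ ∘ dⁱ = 0`. -/
def IsComplex {m : ℕ} (X : Seq 𝒞 m) : Prop :=
  ∀ i : ℕ, X.d i ≫ X.d (i + 1) = 0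

/-- Two morphisms `f, g` of sequences are homotopic.  The morphism `φ i : Xⁱ⁺¹ ⟶ Yⁱ` is the
component of degree `i + 1` of the homotopy; in the last degree `m`, the second summand vanishes,
since `Xᵐ⁺¹` is zero. -/
def Homotopic {m : ℕ} {X Y : Seq 𝒞 m} (f g : X ⟶ Y) : Prop :=
  ∃ φ : ∀ i : ℕ, X.obj (i + 1) ⟶ Y.obj i,
    app g 0 - app f 0 = X.d 0 ≫ φ 0 ∧
    ∀ i : ℕ, app g (i + 1) - app f (i + 1) = φ i ≫ Y.d i + X.d (i + 1) ≫ φ (i + 1)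

lemma Homotopic.refl {m : ℕ} {X Y : Seq 𝒞 m} (f : X ⟶ Y) : Homotopic f f :=
  ⟨fun _ => 0, by simp, by simp⟩

lemma Homotopic.trans {m : ℕ} {X Y : Seq 𝒞 m} {f g h : X ⟶ Y}
    (h₁ : Homotopic f g) (h₂ : Homotopic g h) : Homotopic f h := by
  obtain ⟨φ, a₁, b₁⟩ := h₁
  obtain ⟨ψ, a₂, b₂⟩ := h₂
  refine ⟨fun i => φ i + ψ i, ?_, fun i => ?_⟩
  · rw [Preadditive.comp_add, ← a₁, ← a₂]; abel
  · rw [Preadditive.comp_add, Preadditive.add_comp, add_add_add_comm, ← b₁ i, ← b₂ i]; abel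

lemma Homotopic.comp {m : ℕ} {W X Y Z : Seq 𝒞 m} {f g : X ⟶ Y} (h : Homotopic f g)
    (a : W ⟶ X) (b : Y ⟶ Z) : Homotopic (a ≫ f ≫ b) (a ≫ g ≫ b) := by
  obtain ⟨φ, h₁, h₂⟩ := h
  have key : ∀ i : ℕ, app (a ≫ g ≫ b) i - app (a ≫ f ≫ b) i =
      app a i ≫ (app g i - app f i) ≫ app b i := fun i => by
    simp [app_comp]
  refine ⟨fun i => app a (i + 1) ≫ φ i ≫ app b i, ?_, fun i => ?_⟩
  · rw [key, h₁]
    simp only [Category.assoc]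
    rw [← Category.assoc, ← app_comm a 0, Category.assoc]
  · rw [key, h₂ i]
    simp only [Category.assoc, Preadditive.comp_add, Preadditive.add_comp]
    rw [app_comm b i, ← Category.assoc (W.d (i + 1)), app_comm a (i + 1), Category.assoc]

section Triv

variable [HasZeroObject 𝒞]

/-- The sequence `A ⟶ A ⟶ 0 ⟶ ⋯ ⟶ 0` in degrees `0, …, n+1` with first morphism `𝟙 A`. -/
noncomputable def trivLeft (A : 𝒞) (n : ℕ) : Seq 𝒞 (n + 1) where
  obj i := match i with
    | 0 => A
    | 1 => A
    | _ + 2 => 0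
  d i := match i with
    | 0 => 𝟙 A
    | _ + 1 => 0
  isZero i hi := match i, hi with
    | 0, hi => by omega
    | 1, hi => by omega
    | _ + 2, _ => isZero_zero 𝒞

/-- The sequence `0 ⟶ ⋯ ⟶ 0 ⟶ A ⟶ A` in degrees `0, …, n+1` with last morphism `𝟙 A`. -/
noncomputable def trivRight (A : 𝒞) (n : ℕ) : Seq 𝒞 (n + 1) :=
  snoc (fun i => if i = n then A else 0) (fun _ => 0) n (Z := A) (eqToHom (if_pos rfl))

end Triv

section Cone

variable [HasBinaryBiproducts 𝒞]

/-- The componentwise direct sum. -/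
noncomputable def biprod {m : ℕ} (X Y : Seq 𝒞 m) : Seq 𝒞 m where
  obj i := X.obj i ⊞ Y.obj i
  d i := biprod.map (X.d i) (Y.d i)
  isZero i hi := (biprod_isZero_iff _ _).2 ⟨X.isZero i hi, Y.isZero i hi⟩

variable {X Y : Seq 𝒞 (n + 1)}

/-- `X¹, X² ⊞ Y¹, X³ ⊞ Y², …` -/
noncomputable def coneObj (X Y : Seq 𝒞 (n + 1)) : ℕ → 𝒞
  | 0 => X.obj 1
  | i + 1 => X.obj (i + 2) ⊞ Y.obj (i + 1)

/-- The morphisms `X¹ ⟶ X² ⊞ Y¹ ⟶ X³ ⊞ Y² ⟶ ⋯`. -/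
noncomputable def coneD (f : X ⟶ Y) : ∀ i, coneObj X Y i ⟶ coneObj X Y (i + 1)
  | 0 => biprod.lift (-X.d 1) (app f 1)
  | i + 1 => Biprod.ofComponents (-X.d (i + 2)) (app f (i + 2)) 0 (Y.d (i + 1))

/-- For `i ≥ 1`, the morphism `[fⁱ⁺¹ dⁱ] : Xⁱ⁺¹ ⊞ Yⁱ ⟶ Yⁱ⁺¹`. -/
noncomputable def coneLast (f : X ⟶ Y) : ∀ i, coneObj X Y i ⟶ Y.obj (i + 1)
  | 0 => app f 1
  | i + 1 => biprod.desc (app f (i + 2)) (Y.d (i + 1))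

/-- `X⁰, X¹ ⊞ Y⁰, X² ⊞ Y¹, …` -/
noncomputable def coconeObj (X Y : Seq 𝒞 (n + 1)) : ℕ → 𝒞
  | 0 => X.obj 0
  | i + 1 => X.obj (i + 1) ⊞ Y.obj i

/-- The morphisms `X⁰ ⟶ X¹ ⊞ Y⁰ ⟶ X² ⊞ Y¹ ⟶ ⋯`. -/
noncomputable def coconeD (f : X ⟶ Y) : ∀ i, coconeObj X Y i ⟶ coconeObj X Y (i + 1)
  | 0 => biprod.lift (X.d 0) (app f 0)
  | i + 1 => Biprod.ofComponents (X.d (i + 1)) (app f (i + 1)) 0 (-Y.d i)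

/-- For `i ≥ 1`, the morphism `[fⁱ -dⁱ⁻¹] : Xⁱ ⊞ Yⁱ⁻¹ ⟶ Yⁱ`. -/
noncomputable def coconeLast (f : X ⟶ Y) : ∀ i, coconeObj X Y i ⟶ Y.obj i
  | 0 => app f 0
  | i + 1 => biprod.desc (app f (i + 1)) (-Y.d i)

variable [HasZeroObject 𝒞]

/-- The mapping cone `X¹ ⟶ X² ⊞ Y¹ ⟶ ⋯ ⟶ Xⁿ⁺¹ ⊞ Yⁿ ⟶ Yⁿ⁺¹` of a morphism which is the
identity in degree `0`. -/
noncomputable def cone (f : X ⟶ Y) : Seq 𝒞 (n + 1) :=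
  snoc (coneObj X Y) (coneD f) n (coneLast f n)

/-- The mapping cocone `X⁰ ⟶ X¹ ⊞ Y⁰ ⟶ ⋯ ⟶ Xⁿ ⊞ Yⁿ⁻¹ ⟶ Yⁿ` of a morphism which is the
identity in degree `n+1`; it is the mapping cone formed in the opposite category. -/
noncomputable def cocone (f : X ⟶ Y) : Seq 𝒞 (n + 1) :=
  snoc (coconeObj X Y) (coconeD f) n (coconeLast f n)

end Cone

end Zero

end Seq

/-! ### Extensions and `n`-exangles -/

section Exangulated

variable {𝒞 : Type u} [Category.{v} 𝒞]

section Ext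

variable (E : 𝒞ᵒᵖ ⥤ 𝒞 ⥤ AddCommGrpCat.{w})

/-- The group `E(C, A)` of extensions. -/
abbrev Ext (C A : 𝒞) : Type w := (E.obj (op C)).obj A

variable {E}

/-- `a_* δ`. -/
def push {C A A' : 𝒞} (a : A ⟶ A') (δ : Ext E C A) : Ext E C A' := ((E.obj (op C)).map a).hom δ

/-- `c^* δ`. -/
def pull {C C' A : 𝒞} (c : C' ⟶ C) (δ : Ext E C A) : Ext E C' A := ((E.map c.op).app A).hom δ

end Ext

variable [Preadditive 𝒞]

/-- Biadditivity of `E : 𝒞ᵒᵖ × 𝒞 → Ab`. -/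
structure IsBiadditive (E : 𝒞ᵒᵖ ⥤ 𝒞 ⥤ AddCommGrpCat.{w}) : Prop where
  push_add {C A A' : 𝒞} (a b : A ⟶ A') (δ : Ext E C A) : push (a + b) δ = push a δ + push b δ
  pull_add {C C' A : 𝒞} (c e : C' ⟶ C) (δ : Ext E C A) : pull (c + e) δ = pull c δ + pull e δ

variable (E : 𝒞ᵒᵖ ⥤ 𝒞 ⥤ AddCommGrpCat.{w}) {n : ℕ}

/-- The pair `⟨X, δ⟩` is an `n`-exangle: for every `Q`, the sequences
`𝒞(Q, X⁰) → ⋯ → 𝒞(Q, Xⁿ⁺¹) → E(Q, X⁰)` and `𝒞(Xⁿ⁺¹, Q) → ⋯ → 𝒞(X⁰, Q) → E(Xⁿ⁺¹, Q)`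
are exact. -/
structure IsExangle (X : Seq 𝒞 (n + 1)) (δ : Ext E (X.obj (n + 1)) (X.obj 0)) : Prop where
  exact_left (Q : 𝒞) (i : ℕ) (hi : i < n) :
    Function.Exact (fun g : Q ⟶ X.obj i => g ≫ X.d i)
      (fun g : Q ⟶ X.obj (i + 1) => g ≫ X.d (i + 1))
  exact_left_last (Q : 𝒞) :
    Function.Exact (fun g : Q ⟶ X.obj n => g ≫ X.d n)
      (fun g : Q ⟶ X.obj (n + 1) => pull g δ)
  exact_right (Q : 𝒞) (i : ℕ) (hi : i < n) :
    Function.Exact (fun g : X.obj (i + 2) ⟶ Q => X.d (i + 1) ≫ g)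
      (fun g : X.obj (i + 1) ⟶ Q => X.d i ≫ g)
  exact_right_last (Q : 𝒞) :
    Function.Exact (fun g : X.obj 1 ⟶ Q => X.d 0 ≫ g)
      (fun g : X.obj 0 ⟶ Q => push g δ)

/-! ### Complexes with given end terms, and realizations -/

/-- A sequence `X⁰ ⟶ ⋯ ⟶ Xⁿ⁺¹` with identifications `X⁰ ≅ A` and `Xⁿ⁺¹ ≅ C` of its end terms. -/
structure EndSeq (n : ℕ) (A C : 𝒞) where
  seq : Seq 𝒞 (n + 1)
  left : seq.obj 0 ≅ A
  right : seq.obj (n + 1) ≅ C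

/-- A complex `X⁰ ⟶ ⋯ ⟶ Xⁿ⁺¹` with end terms `A` and `C`. -/
structure EndComplex (n : ℕ) (A C : 𝒞) extends EndSeq n A C where
  isComplex : seq.IsComplex

/-- `f` is of the form `(a, f¹, …, fⁿ, c)`. -/
def IsLift {A B C D : 𝒞} (X : EndSeq n A C) (Y : EndSeq n B D) (a : A ⟶ B) (c : C ⟶ D)
    (f : X.seq ⟶ Y.seq) : Prop :=
  Seq.app f 0 ≫ Y.left.hom = X.left.hom ≫ a ∧
    Seq.app f (n + 1) ≫ Y.right.hom = X.right.hom ≫ c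

/-- Homotopy equivalence of complexes with end terms `A` and `C`, through morphisms which are
the identity on `A` and on `C`. -/
def HtpyEquiv {A C : 𝒞} (X Y : EndComplex n A C) : Prop :=
  ∃ (f : X.seq ⟶ Y.seq) (g : Y.seq ⟶ X.seq),
    IsLift X.toEndSeq Y.toEndSeq (𝟙 A) (𝟙 C) f ∧ IsLift Y.toEndSeq X.toEndSeq (𝟙 A) (𝟙 C) g ∧
      Seq.Homotopic (f ≫ g) (𝟙 X.seq) ∧ Seq.Homotopic (g ≫ f) (𝟙 Y.seq)

set_option linter.unusedSectionVars false in
lemma IsLift.comp_id {A C : 𝒞} {X Y Z : EndSeq n A C} {f : X.seq ⟶ Y.seq} {g : Y.seq ⟶ Z.seq}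
    (hf : IsLift X Y (𝟙 A) (𝟙 C) f) (hg : IsLift Y Z (𝟙 A) (𝟙 C) g) :
    IsLift X Z (𝟙 A) (𝟙 C) (f ≫ g) := by
  obtain ⟨h₁, h₂⟩ := hf
  obtain ⟨h₃, h₄⟩ := hg
  simp only [Category.comp_id] at h₁ h₂ h₃ h₄
  constructor
  · rw [Seq.app_comp, Category.assoc, h₃, h₁, Category.comp_id]
  · rw [Seq.app_comp, Category.assoc, h₄, h₂, Category.comp_id]

/-- Homotopy equivalence as an equivalence relation. -/
def htpySetoid (n : ℕ) (A C : 𝒞) : Setoid (EndComplex n A C) where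
  r := HtpyEquiv
  iseqv :=
    { refl := fun X =>
        ⟨𝟙 _, 𝟙 _, by simp [IsLift, Seq.app_id], by simp [IsLift, Seq.app_id],
          by rw [Category.comp_id]; exact .refl _, by rw [Category.comp_id]; exact .refl _⟩
      symm := fun ⟨f, g, h₁, h₂, h₃, h₄⟩ => ⟨g, f, h₂, h₁, h₄, h₃⟩
      trans := by
        rintro X Y Z ⟨f, g, h₁, h₂, h₃, h₄⟩ ⟨f', g', h₁', h₂', h₃', h₄'⟩
        refine ⟨f ≫ f', g' ≫ g, h₁.comp_id h₁', h₂'.comp_id h₂, ?_, ?_⟩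
        · have h := h₃'.comp f g
          simp only [Category.assoc, Category.id_comp] at h ⊢
          exact h.trans h₃
        · have h := h₄.comp g' f'
          simp only [Category.assoc, Category.id_comp] at h ⊢
          exact h.trans h₄' }

/-- A realization of `E`: to each extension `δ ∈ E(C, A)` it assigns a homotopy equivalence class
of complexes with end terms `A` and `C`, such that every morphism of extensions lifts. -/
structure Realization (n : ℕ) where
  cls {A C : 𝒞} (δ : Ext E C A) : Quotient (htpySetoid n A C)
  exists_lift {A B C D : 𝒞} (δ : Ext E C A) (ρ : Ext E D B) (a : A ⟶ B) (c : C ⟶ D)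
    (h : push a δ = pull c ρ) (X : EndComplex n A C) (Y : EndComplex n B D)
    (hX : cls δ = Quotient.mk _ X) (hY : cls ρ = Quotient.mk _ Y) :
    ∃ f : X.seq ⟶ Y.seq, IsLift X.toEndSeq Y.toEndSeq a c f

section Triv

variable [HasZeroObject 𝒞]

/-- `A ⟶ A ⟶ 0 ⟶ ⋯ ⟶ 0` as a sequence with end terms `A` and `0`. -/
noncomputable def EndSeq.trivLeft (n : ℕ) [NeZero n] (A : 𝒞) : EndSeq n A (0 : 𝒞) where
  seq := Seq.trivLeft A n
  left := Iso.refl A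
  right := eqToIso (by
    obtain ⟨m, rfl⟩ := Nat.exists_eq_succ_of_ne_zero (NeZero.ne n)
    rfl)

/-- `0 ⟶ ⋯ ⟶ 0 ⟶ A ⟶ A` as a sequence with end terms `0` and `A`. -/
noncomputable def EndSeq.trivRight (n : ℕ) [NeZero n] (A : 𝒞) : EndSeq n (0 : 𝒞) A where
  seq := Seq.trivRight A n
  left := Seq.snocIso _ _ n _ 0 (Nat.zero_le n) ≪≫ eqToIso (if_neg (NeZero.ne n).symm)
  right := Seq.snocLastIso _ _ n _

end Triv

section Cone

variable [HasZeroObject 𝒞] [HasBinaryBiproducts 𝒞]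

/-- The mapping cone as a sequence with end terms `X¹` and `D`. -/
noncomputable def EndSeq.cone {A B C D : 𝒞} {X : EndSeq n A C} {Y : EndSeq n B D}
    (f : X.seq ⟶ Y.seq) : EndSeq n (X.seq.obj 1) D where
  seq := Seq.cone f
  left := Seq.snocIso _ _ n _ 0 (Nat.zero_le n)
  right := Seq.snocLastIso _ _ n _ ≪≫ Y.right

/-- The mapping cocone as a sequence with end terms `A` and `Yⁿ`. -/
noncomputable def EndSeq.cocone {A B C D : 𝒞} {X : EndSeq n A C} {Y : EndSeq n B D}
    (f : X.seq ⟶ Y.seq) : EndSeq n A (Y.seq.obj n) where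
  seq := Seq.cocone f
  left := Seq.snocIso _ _ n _ 0 (Nat.zero_le n) ≪≫ X.left
  right := Seq.snocLastIso _ _ n _

end Cone

variable {E}

namespace Realization

variable (s : Realization E n)

/-- `X` realizes `δ`, that is, `X` is a complex and `s(δ) = [X]`. -/
def Realizes {A C : 𝒞} (δ : Ext E C A) (X : EndSeq n A C) : Prop :=
  ∃ hX : X.seq.IsComplex, s.cls δ = Quotient.mk _ ⟨X, hX⟩

/-- `⟨X, δ⟩` is distinguished: `s(δ) = [X]`, where `δ ∈ E(Xⁿ⁺¹, X⁰)`. -/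
def Distinguished (X : Seq 𝒞 (n + 1)) (δ : Ext E (X.obj (n + 1)) (X.obj 0)) : Prop :=
  s.Realizes δ ⟨X, Iso.refl _, Iso.refl _⟩

/-- `f` is, up to isomorphism of arrows, the first morphism of a conflation. -/
def Inflation {A B : 𝒞} (f : A ⟶ B) : Prop :=
  ∃ (X : Seq 𝒞 (n + 1)) (δ : Ext E (X.obj (n + 1)) (X.obj 0)),
    s.Distinguished X δ ∧ Nonempty (Arrow.mk (X.d 0) ≅ Arrow.mk f)

/-- `f` is, up to isomorphism of arrows, the last morphism of a conflation. -/
def Deflation {A B : 𝒞} (f : A ⟶ B) : Prop :=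
  ∃ (X : Seq 𝒞 (n + 1)) (δ : Ext E (X.obj (n + 1)) (X.obj 0)),
    s.Distinguished X δ ∧ Nonempty (Arrow.mk (X.d n) ≅ Arrow.mk f)

variable [HasZeroObject 𝒞]

/-- Exact realizations. -/
structure IsExact [NeZero n] : Prop where
  /-- If `X` realizes `δ`, then `⟨X, δ⟩` is an `n`-exangle. -/
  isExangle {A C : 𝒞} (δ : Ext E C A) (X : EndSeq n A C) (hX : s.Realizes δ X) :
    IsExangle E X.seq (pull X.right.hom (push X.left.inv δ))
  realizes_trivLeft (A : 𝒞) : s.Realizes (0 : Ext E 0 A) (EndSeq.trivLeft n A)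
  realizes_trivRight (A : 𝒞) : s.Realizes (0 : Ext E A 0) (EndSeq.trivRight n A)

variable [HasBinaryBiproducts 𝒞]

/-- `(𝒞, E, s)` is an `n`-exangulated category. -/
structure IsExangulated [NeZero n] : Prop where
  isBiadditive : IsBiadditive E
  isExact : s.IsExact
  /-- Inflations are closed under composition. -/
  inflation_comp {A B C : 𝒞} (f : A ⟶ B) (g : B ⟶ C) :
    s.Inflation f → s.Inflation g → s.Inflation (f ≫ g)
  /-- Deflations are closed under composition. -/
  deflation_comp {A B C : 𝒞} (f : A ⟶ B) (g : B ⟶ C) :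
    s.Deflation f → s.Deflation g → s.Deflation (f ≫ g)
  /-- For `ρ ∈ E(D, A)` and `c : C ⟶ D`, if `X` realizes `c^*ρ` and `Y` realizes `ρ`, then
  `(𝟙 A, c)` has a lift `f : X ⟶ Y` whose mapping cone realizes `(d_X⁰)_* ρ`. -/
  exists_good_lift {A C D : 𝒞} (ρ : Ext E D A) (c : C ⟶ D) (X : EndSeq n A C) (Y : EndSeq n A D)
    (hX : s.Realizes (pull c ρ) X) (hY : s.Realizes ρ Y) :
    ∃ f : X.seq ⟶ Y.seq, IsLift X Y (𝟙 A) c f ∧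
      s.Realizes (push (X.left.inv ≫ X.seq.d 0) ρ) (EndSeq.cone (X := X) (Y := Y) f)
  /-- For `δ ∈ E(C, A)` and `a : A ⟶ B`, if `X` realizes `δ` and `Y` realizes `a_*δ`, then
  `(a, 𝟙 C)` has a lift `f : X ⟶ Y` whose mapping cocone realizes `(d_Yⁿ)^* δ`. -/
  exists_good_lift_op {A B C : 𝒞} (δ : Ext E C A) (a : A ⟶ B) (X : EndSeq n A C)
    (Y : EndSeq n B C) (hX : s.Realizes δ X) (hY : s.Realizes (push a δ) Y) :
    ∃ f : X.seq ⟶ Y.seq, IsLift X Y a (𝟙 C) f ∧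
      s.Realizes (pull (Y.seq.d n ≫ Y.right.hom) δ) (EndSeq.cocone (X := X) (Y := Y) f)

end Realization

end Exangulated

/-! ### `(n+2)`-angulated categories -/

section Angulated

variable {𝒞 : Type u} [Category.{v} 𝒞]

/-- An `(n+2)`-`S`-sequence `X⁰ ⟶ X¹ ⟶ ⋯ ⟶ Xⁿ⁺¹ ⟶ S X⁰`. -/
structure SigmaSeq (S : 𝒞 ⥤ 𝒞) (n : ℕ) where
  seq : Seq 𝒞 (n + 1)
  conn : seq.obj (n + 1) ⟶ S.obj (seq.obj 0)

namespace SigmaSeq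

variable {S : 𝒞 ⥤ 𝒞} {n : ℕ}

/-- Morphisms of `(n+2)`-`S`-sequences. -/
@[ext]
structure Hom (X Y : SigmaSeq S n) where
  hom : X.seq ⟶ Y.seq
  comm : X.conn ≫ S.map (Seq.app hom 0) = Seq.app hom (n + 1) ≫ Y.conn

instance : Category (SigmaSeq S n) where
  Hom := Hom
  id X := { hom := 𝟙 X.seq, comm := by simp [Seq.app_id] }
  comp f g :=
    { hom := f.hom ≫ g.hom
      comm := by
        rw [Seq.app_comp, Seq.app_comp, S.map_comp, ← Category.assoc, f.comm, Category.assoc,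
          g.comm, Category.assoc] }
  id_comp f := by apply Hom.ext; exact Category.id_comp _
  comp_id f := by apply Hom.ext; exact Category.comp_id _
  assoc f g h := by apply Hom.ext; exact Category.assoc _ _ _

/-- The underlying morphism of sequences. -/
def toSeqHom {X Y : SigmaSeq S n} (f : X ⟶ Y) : X.seq ⟶ Y.seq := Hom.hom f

variable [Preadditive 𝒞] [HasZeroObject 𝒞]

/-- The `S`-sequence `K⁰ ⟶ ⋯ ⟶ Kⁿ ⟶ Z ⟶ S K⁰` whose last two morphisms are `f` and `e`. -/
noncomputable def ofSnoc (K : ℕ → 𝒞) (dK : ∀ i, K i ⟶ K (i + 1)) {Z : 𝒞} (f : K n ⟶ Z)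
    (e : Z ⟶ S.obj (K 0)) : SigmaSeq S n where
  seq := Seq.snoc K dK n f
  conn :=
    (Seq.snocLastIso K dK n f).hom ≫ e ≫ S.map (Seq.snocIso K dK n f 0 (Nat.zero_le n)).inv

/-- The left rotation `X¹ ⟶ ⋯ ⟶ Xⁿ⁺¹ ⟶ S X⁰ ⟶ S X¹`, with last morphism `(-1)ⁿ S d⁰`. -/
noncomputable def rotate (X : SigmaSeq S n) : SigmaSeq S n :=
  ofSnoc (fun i => X.seq.obj (i + 1)) (fun i => X.seq.d (i + 1)) (Z := S.obj (X.seq.obj 0))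
    X.conn ((-1 : ℤ) ^ n • S.map (X.seq.d 0))

/-- The trivial sequence `A ⟶ A ⟶ 0 ⟶ ⋯ ⟶ 0 ⟶ S A` with first morphism `𝟙 A`. -/
noncomputable def triv (A : 𝒞) : SigmaSeq S n where
  seq := Seq.trivLeft A n
  conn := 0

variable [HasBinaryBiproducts 𝒞]

/-- The direct sum of two `S`-sequences, with `S X⁰ ⊞ S Y⁰` identified with `S (X⁰ ⊞ Y⁰)`. -/
noncomputable def biprod (X Y : SigmaSeq S n) : SigmaSeq S n where
  seq := X.seq.biprod Y.seq
  conn := biprod.desc (X.conn ≫ S.map biprod.inl) (Y.conn ≫ S.map biprod.inr)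

/-- The cone `X¹ ⊞ Y⁰ ⟶ ⋯ ⟶ Xⁿ⁺¹ ⊞ Yⁿ ⟶ S X⁰ ⊞ Yⁿ⁺¹ ⟶ S X¹ ⊞ S Y⁰` of a morphism of
`S`-sequences, with `S X¹ ⊞ S Y⁰` identified with `S (X¹ ⊞ Y⁰)`. -/
noncomputable def cone {X Y : SigmaSeq S n} (f : X ⟶ Y) : SigmaSeq S n :=
  ofSnoc (fun i => X.seq.obj (i + 1) ⊞ Y.seq.obj i)
    (fun i =>
      Biprod.ofComponents (-X.seq.d (i + 1)) (Seq.app (toSeqHom f) (i + 1)) 0 (Y.seq.d i))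
    (Z := S.obj (X.seq.obj 0) ⊞ Y.seq.obj (n + 1))
    (Biprod.ofComponents (-X.conn) (Seq.app (toSeqHom f) (n + 1)) 0 (Y.seq.d n))
    (biprod.desc
      (-S.map (X.seq.d 0) ≫ S.map biprod.inl +
        S.map (Seq.app (toSeqHom f) 0) ≫ S.map biprod.inr)
      (Y.conn ≫ S.map biprod.inr))

end SigmaSeq

/-- The class `N` of `(n+2)`-`S`-sequences makes `(𝒞, S, N)` an `(n+2)`-angulated category. -/
structure IsAngulated [Preadditive 𝒞] [HasZeroObject 𝒞] [HasBinaryBiproducts 𝒞]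
    (S : 𝒞 ⥤ 𝒞) (n : ℕ) (N : Set (SigmaSeq S n)) : Prop where
  /-- `N` is closed under isomorphisms, direct sums and direct summands. -/
  mem_of_iso {X Y : SigmaSeq S n} (e : X ≅ Y) : X ∈ N → Y ∈ N
  biprod_mem_iff (X Y : SigmaSeq S n) : X.biprod Y ∈ N ↔ X ∈ N ∧ Y ∈ N
  /-- `N` contains the trivial sequences. -/
  triv_mem (A : 𝒞) : SigmaSeq.triv A ∈ N
  /-- Every morphism is the first morphism of a member of `N` (on the nose, or up to
  isomorphism of arrows, which is the same since `N` is closed under isomorphisms). -/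
  exists_first {A B : 𝒞} (f : A ⟶ B) :
    ∃ X ∈ N, Nonempty (Arrow.mk (X.seq.d 0) ≅ Arrow.mk f)
  /-- A sequence is in `N` if and only if its left rotation is. -/
  rotate_mem_iff (X : SigmaSeq S n) : X.rotate ∈ N ↔ X ∈ N
  /-- A commutative square on the first morphisms extends to a morphism of sequences. -/
  exists_hom {X Y : SigmaSeq S n} (hX : X ∈ N) (hY : Y ∈ N)
    (a : X.seq.obj 0 ⟶ Y.seq.obj 0) (b : X.seq.obj 1 ⟶ Y.seq.obj 1)
    (hab : X.seq.d 0 ≫ b = a ≫ Y.seq.d 0) :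
    ∃ f : X ⟶ Y, Seq.app (SigmaSeq.toSeqHom f) 0 = a ∧ Seq.app (SigmaSeq.toSeqHom f) 1 = b
  /-- Moreover, this extension can be chosen with cone in `N`. -/
  exists_hom_cone_mem {X Y : SigmaSeq S n} (hX : X ∈ N) (hY : Y ∈ N)
    (a : X.seq.obj 0 ⟶ Y.seq.obj 0) (b : X.seq.obj 1 ⟶ Y.seq.obj 1)
    (hab : X.seq.d 0 ≫ b = a ≫ Y.seq.d 0) :
    ∃ f : X ⟶ Y, Seq.app (SigmaSeq.toSeqHom f) 0 = a ∧ Seq.app (SigmaSeq.toSeqHom f) 1 = b ∧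
      SigmaSeq.cone f ∈ N

variable [Preadditive 𝒞]

/-- The bifunctor `𝒞(-, S -)`, that is, `(C, A) ↦ 𝒞(C, S A)`. -/
def homShift (S : 𝒞 ⥤ 𝒞) : 𝒞ᵒᵖ ⥤ 𝒞 ⥤ AddCommGrpCat.{v} :=
  preadditiveCoyoneda ⋙ (Functor.whiskeringLeft 𝒞 𝒞 AddCommGrpCat.{v}).obj S

/-- A morphism `C ⟶ S A` regarded as an extension in `𝒞(C, S A)`. -/
def toExt {S : 𝒞 ⥤ 𝒞} {C A : 𝒞} (δ : C ⟶ S.obj A) : Ext (homShift S) C A := δ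

lemma push_toExt {S : 𝒞 ⥤ 𝒞} {C A A' : 𝒞} (a : A ⟶ A') (δ : C ⟶ S.obj A) :
    push a (toExt δ) = toExt (δ ≫ S.map a) := rfl

lemma pull_toExt {S : 𝒞 ⥤ 𝒞} {C C' A : 𝒞} (c : C' ⟶ C) (δ : C ⟶ S.obj A) :
    pull c (toExt δ) = toExt (c ≫ δ) := rfl

/-- The class of `(n+2)`-`S`-sequences given by the distinguished `n`-exangles of `s`. -/
def Realization.angles {S : 𝒞 ⥤ 𝒞} {n : ℕ} (s : Realization (homShift S) n) :
    Set (SigmaSeq S n) :=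
  {X | s.Distinguished X.seq (toExt X.conn)}

end Angulated

end NExang

/-! For `𝒞(-, S -)` every extension comes from an identity: `δ : C ⟶ S A` is the pullback of `𝟙 (S
A)` along `δ`, and `S a` is its pushforward along `a`. In a realization of `𝟙 (S A)`, exactness
kills the first and last differentials, so it is also realized by `A → 0 → ⋯ → 0 → S A`
(`IsExact.realizes_shiftEnd`). Lifting from or to this sequence makes one summand of the inner terms
of a mapping cone or cocone vanish. The cone for `δ` is then, up to signs, the left rotation of a
sequence with connecting morphism `δ`; the cocones undo a rotation and embed any morphism as a first
differential. Lifting a square on the first morphisms is lifting of a morphism of extensions between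
rotated sequences.

Since `s` only determines homotopy classes, one needs a recognition principle: a right exact complex
realizes `δ` as soon as it has lifts of the identities to and from some realization of `δ`
(`IsExact.realizes_of_lifts`). The composites differ from the identity by an `h` vanishing on both
ends; `h` need not be null-homotopic, but its square is. Closure under isomorphisms, sums and
summands follows.

For the cone axiom, let `c` complete `(a, b)` at the last term. Compare `X ⊕ (Y⁰ = Y⁰)` with `(X⁰ →
0 → ⋯ → S X⁰) ⊕ Y`. Both start at `X⁰ ⊕ Y⁰`, and once this term is twisted by `a` in the first
sequence, its extension is the pullback of the second one along `(X.conn, c)`. The mapping cone of a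
good lift is the cone of its corner `X ⟶ Y`, up to a sign; a homotopy then corrects degree `1` to
`b` without changing the isomorphism class of the cone. -/

namespace NExang

/-! ### Morphisms and direct sums of finite sequences -/

namespace Seq

section Hom

variable {𝒞 : Type u} [Category.{v} 𝒞] {m : ℕ}

lemma hom_ext {X Y : Seq 𝒞 m} {f g : X ⟶ Y} (h : ∀ i, app f i = app g i) : f = g :=
  Hom.ext (funext h)

/-- Construct a morphism of sequences from its components. -/
def homMk {X Y : Seq 𝒞 m} (φ : ∀ i, X.obj i ⟶ Y.obj i)
    (hφ : ∀ i, X.d i ≫ φ (i + 1) = φ i ≫ Y.d i) : X ⟶ Y :=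
  Hom.mk φ hφ

@[simp]
lemma app_homMk {X Y : Seq 𝒞 m} (φ : ∀ i, X.obj i ⟶ Y.obj i)
    (hφ : ∀ i, X.d i ≫ φ (i + 1) = φ i ≫ Y.d i) (i : ℕ) : app (homMk φ hφ) i = φ i := rfl

/-- A morphism of sequences which is an isomorphism in every degree is an isomorphism. -/
noncomputable def isoOfApp {X Y : Seq 𝒞 m} (f : X ⟶ Y) (h : ∀ i, IsIso (app f i)) : X ≅ Y where
  hom := f
  inv := homMk (fun i => (@asIso _ _ _ _ (app f i) (h i)).inv) fun i => by
    rw [Iso.eq_inv_comp, ← Category.assoc, Iso.comp_inv_eq]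
    exact (app_comm f i).symm
  hom_inv_id := hom_ext fun i => (@asIso _ _ _ _ (app f i) (h i)).hom_inv_id
  inv_hom_id := hom_ext fun i => (@asIso _ _ _ _ (app f i) (h i)).inv_hom_id

end Hom

section Snoc

variable {𝒞 : Type u} [Category.{v} 𝒞] [Preadditive 𝒞] [HasZeroObject 𝒞]

section

variable {K : ℕ → 𝒞} {dK : ∀ i, K i ⟶ K (i + 1)} {m : ℕ} {Z : 𝒞} {f : K m ⟶ Z}

lemma snoc_d' (i : ℕ) (hi : i < m) :
    (snoc K dK m f).d i =
      (snocIso K dK m f i hi.le).hom ≫ dK i ≫ (snocIso K dK m f (i + 1) hi).inv := by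
  rw [← Category.assoc, Iso.eq_comp_inv, snoc_d]

lemma snoc_d_last' :
    (snoc K dK m f).d m =
      (snocIso K dK m f m le_rfl).hom ≫ f ≫ (snocLastIso K dK m f).inv := by
  rw [← Category.assoc, Iso.eq_comp_inv, snoc_d_last]

variable {X : Seq 𝒞 (m + 1)}

/-- A morphism to `K⁰ ⟶ ⋯ ⟶ Kᵐ ⟶ Z` given by its components. -/
noncomputable def toSnoc (α : ∀ i, i ≤ m → (X.obj i ⟶ K i)) (β : X.obj (m + 1) ⟶ Z)
    (hα : ∀ i (hi : i < m), X.d i ≫ α (i + 1) hi = α i hi.le ≫ dK i)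
    (hβ : X.d m ≫ β = α m le_rfl ≫ f) : X ⟶ snoc K dK m f :=
  homMk
    (fun i =>
      if h : i ≤ m then α i h ≫ (snocIso K dK m f i h).inv
      else if h' : i = m + 1 then
        eqToHom (congrArg X.obj h') ≫ β ≫ (snocLastIso K dK m f).inv ≫
          eqToHom (congrArg (snoc K dK m f).obj h'.symm)
      else 0)
    fun i => by
      rcases lt_trichotomy i m with hi | rfl | hi
      · have h₁ : i + 1 ≤ m := hi
        rw [dif_pos h₁, dif_pos hi.le, snoc_d' i hi, ← Category.assoc, hα i hi]
        simp
      · rw [dif_neg (by omega), dif_pos rfl, dif_pos le_rfl, snoc_d_last']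
        simp [reassoc_of% hβ]
      · exact ((snoc K dK m f).isZero (i + 1) (by omega)).eq_of_tgt _ _

section

variable (α : ∀ i, i ≤ m → (X.obj i ⟶ K i)) (β : X.obj (m + 1) ⟶ Z)
    (hα : ∀ i (hi : i < m), X.d i ≫ α (i + 1) hi = α i hi.le ≫ dK i)
    (hβ : X.d m ≫ β = α m le_rfl ≫ f)

lemma app_toSnoc (i : ℕ) (hi : i ≤ m) :
    app (toSnoc (f := f) α β hα hβ) i = α i hi ≫ (snocIso K dK m f i hi).inv :=
  dif_pos hi

lemma app_toSnoc_last :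
    app (toSnoc (f := f) α β hα hβ) (m + 1) = β ≫ (snocLastIso K dK m f).inv := by
  refine (dif_neg (by omega)).trans ((dif_pos rfl).trans ?_)
  simp

end

/-- A morphism from `K⁰ ⟶ ⋯ ⟶ Kᵐ ⟶ Z` given by its components. -/
noncomputable def fromSnoc (α : ∀ i, i ≤ m → (K i ⟶ X.obj i)) (β : Z ⟶ X.obj (m + 1))
    (hα : ∀ i (hi : i < m), dK i ≫ α (i + 1) hi = α i hi.le ≫ X.d i)
    (hβ : f ≫ β = α m le_rfl ≫ X.d m) : snoc K dK m f ⟶ X :=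
  homMk
    (fun i =>
      if h : i ≤ m then (snocIso K dK m f i h).hom ≫ α i h
      else if h' : i = m + 1 then
        eqToHom (congrArg (snoc K dK m f).obj h') ≫ (snocLastIso K dK m f).hom ≫ β ≫
          eqToHom (congrArg X.obj h'.symm)
      else 0)
    fun i => by
      rcases lt_trichotomy i m with hi | rfl | hi
      · have h₁ : i + 1 ≤ m := hi
        rw [dif_pos h₁, dif_pos hi.le, snoc_d' i hi]
        simp [hα i hi]
      · rw [dif_neg (by omega), dif_pos rfl, dif_pos le_rfl, snoc_d_last']
        simp [hβ]
      · exact (X.isZero (i + 1) (by omega)).eq_of_tgt _ _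

variable (α : ∀ i, i ≤ m → (K i ⟶ X.obj i)) (β : Z ⟶ X.obj (m + 1))
    (hα : ∀ i (hi : i < m), dK i ≫ α (i + 1) hi = α i hi.le ≫ X.d i)
    (hβ : f ≫ β = α m le_rfl ≫ X.d m)

lemma app_fromSnoc (i : ℕ) (hi : i ≤ m) :
    app (fromSnoc (f := f) α β hα hβ) i = (snocIso K dK m f i hi).hom ≫ α i hi :=
  dif_pos hi

lemma app_fromSnoc_last :
    app (fromSnoc (f := f) α β hα hβ) (m + 1) = (snocLastIso K dK m f).hom ≫ β := by
  refine (dif_neg (by omega)).trans ((dif_pos rfl).trans ?_)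
  simp

lemma isIso_app_fromSnoc (h₁ : ∀ i (hi : i ≤ m), IsIso (α i hi)) (h₂ : IsIso β) (i : ℕ) :
    IsIso (app (fromSnoc (f := f) α β hα hβ) i) := by
  rcases lt_trichotomy i (m + 1) with hi | rfl | hi
  · have := h₁ i (by omega)
    rw [app_fromSnoc α β hα hβ i (by omega)]
    infer_instance
  · rw [app_fromSnoc_last]
    infer_instance
  · exact isIso_of_source_target_iso_zero _ ((snoc K dK m f).isZero i hi).isoZero
      (X.isZero i hi).isoZero

end

end Snoc

section Biprod

variable {𝒞 : Type u} [Category.{v} 𝒞] [Preadditive 𝒞] [HasBinaryBiproducts 𝒞] {m : ℕ}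
  (X Y : Seq 𝒞 m)

/-- The first inclusion into a direct sum of sequences. -/
noncomputable def biprodInl : X ⟶ X.biprod Y :=
  homMk (fun _ => biprod.inl) fun i => (biprod.inl_map (X.d i) (Y.d i)).symm

/-- The second inclusion into a direct sum of sequences. -/
noncomputable def biprodInr : Y ⟶ X.biprod Y :=
  homMk (fun _ => biprod.inr) fun i => (biprod.inr_map (X.d i) (Y.d i)).symm

/-- The first projection from a direct sum of sequences. -/
noncomputable def biprodFst : X.biprod Y ⟶ X :=
  homMk (fun _ => biprod.fst) fun i => biprod.map_fst (X.d i) (Y.d i)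

/-- The second projection from a direct sum of sequences. -/
noncomputable def biprodSnd : X.biprod Y ⟶ Y :=
  homMk (fun _ => biprod.snd) fun i => biprod.map_snd (X.d i) (Y.d i)

lemma biprodInl_fst : biprodInl X Y ≫ biprodFst X Y = 𝟙 X := hom_ext fun i =>
  biprod.inl_fst (X := X.obj i) (Y := Y.obj i)

lemma biprodInr_snd : biprodInr X Y ≫ biprodSnd X Y = 𝟙 Y := hom_ext fun i =>
  biprod.inr_snd (X := X.obj i) (Y := Y.obj i)

lemma app_biprodInl_fst (i : ℕ) : app (biprodInl X Y) i ≫ app (biprodFst X Y) i = 𝟙 _ :=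
  biprod.inl_fst (X := X.obj i) (Y := Y.obj i)

lemma app_biprodInr_snd (i : ℕ) : app (biprodInr X Y) i ≫ app (biprodSnd X Y) i = 𝟙 _ :=
  biprod.inr_snd (X := X.obj i) (Y := Y.obj i)

lemma app_biprodInl_snd (i : ℕ) : app (biprodInl X Y) i ≫ app (biprodSnd X Y) i = 0 :=
  biprod.inl_snd (X := X.obj i) (Y := Y.obj i)

lemma app_biprodInr_fst (i : ℕ) : app (biprodInr X Y) i ≫ app (biprodFst X Y) i = 0 :=
  biprod.inr_fst (X := X.obj i) (Y := Y.obj i)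

lemma biprod_total (i : ℕ) :
    app (biprodFst X Y) i ≫ app (biprodInl X Y) i +
      app (biprodSnd X Y) i ≫ app (biprodInr X Y) i = 𝟙 _ :=
  biprod.total (X := X.obj i) (Y := Y.obj i)

variable {X Y}

lemma biprod_hom_ext' {i : ℕ} {Q : 𝒞} {f g : (X.biprod Y).obj i ⟶ Q}
    (h₁ : app (biprodInl X Y) i ≫ f = app (biprodInl X Y) i ≫ g)
    (h₂ : app (biprodInr X Y) i ≫ f = app (biprodInr X Y) i ≫ g) : f = g :=
  biprod.hom_ext' (X := X.obj i) (Y := Y.obj i) f g h₁ h₂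

end Biprod

/-! ### Homotopies obtained from right exactness -/

section RightExact

variable {𝒞 : Type u} [Category.{v} 𝒞] [Preadditive 𝒞] {n : ℕ}

/-- `𝒞(Xⁿ⁺¹, Q) → ⋯ → 𝒞(X⁰, Q)` is exact at the inner terms: a morphism from `Xⁱ⁺¹` which is
killed by `dⁱ` factors through `dⁱ⁺¹`. -/
def RightExact (X : Seq 𝒞 (n + 1)) : Prop :=
  ∀ ⦃Q : 𝒞⦄ (i : ℕ), i < n → ∀ g : X.obj (i + 1) ⟶ Q, X.d i ≫ g = 0 → ∃ t, X.d (i + 1) ≫ t = g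

variable {X Y : Seq 𝒞 (n + 1)}

lemma IsComplex.of_retract (hX : X.IsComplex) (ι : Y ⟶ X) (π : X ⟶ Y) (h : ι ≫ π = 𝟙 Y) :
    Y.IsComplex := fun i => by
  have h₁ : app ι (i + 2) ≫ app π (i + 2) = 𝟙 _ := by rw [← app_comp, h, app_id]
  rw [← Category.comp_id (Y.d i ≫ Y.d (i + 1)), ← h₁, Category.assoc,
    ← Category.assoc (Y.d (i + 1)), app_comm, Category.assoc, ← Category.assoc, app_comm,
    Category.assoc, reassoc_of% (hX i), zero_comp, comp_zero]

lemma RightExact.of_retract (hX : X.RightExact) (ι : Y ⟶ X) (π : X ⟶ Y) (h : ι ≫ π = 𝟙 Y) :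
    Y.RightExact := fun Q i hi g hg => by
  have h₁ : app ι (i + 1) ≫ app π (i + 1) = 𝟙 _ := by rw [← app_comp, h, app_id]
  obtain ⟨t, ht⟩ := hX i hi (app π (i + 1) ≫ g) (by
    rw [← Category.assoc, app_comm, Category.assoc, hg, comp_zero])
  refine ⟨app ι (i + 2) ≫ t, ?_⟩
  rw [← Category.assoc, app_comm, Category.assoc, ht, ← Category.assoc, h₁, Category.id_comp]

lemma IsComplex.biprod [HasBinaryBiproducts 𝒞] (hX : X.IsComplex) (hY : Y.IsComplex) :
    (X.biprod Y).IsComplex := fun i => by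
  refine biprod_hom_ext' ?_ ?_
  · rw [← reassoc_of% app_comm, ← app_comm, reassoc_of% (hX i), zero_comp, comp_zero]
  · rw [← reassoc_of% app_comm, ← app_comm, reassoc_of% (hY i), zero_comp, comp_zero]

lemma RightExact.biprod [HasBinaryBiproducts 𝒞] (hX : X.RightExact) (hY : Y.RightExact) :
    (X.biprod Y).RightExact := fun Q i hi g hg => by
  obtain ⟨t, ht⟩ := hX i hi (app (biprodInl X Y) (i + 1) ≫ g) (by
    rw [reassoc_of% app_comm, hg, comp_zero])
  obtain ⟨u, hu⟩ := hY i hi (app (biprodInr X Y) (i + 1) ≫ g) (by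
    rw [reassoc_of% app_comm, hg, comp_zero])
  refine ⟨app (biprodFst X Y) _ ≫ t + app (biprodSnd X Y) _ ≫ u, ?_⟩
  rw [Preadditive.comp_add, reassoc_of% app_comm, reassoc_of% app_comm, ht, hu,
    ← Category.assoc, ← Category.assoc, ← Preadditive.add_comp, biprod_total, Category.id_comp]

open Classical in
/-- A partial contraction of an endomorphism vanishing in degree `0`. -/
noncomputable def partialHomotopy (h : X ⟶ X) : ∀ i : ℕ, X.obj (i + 1) ⟶ X.obj i
  | 0 => 0
  | i + 1 =>
    if H : ∃ t, X.d (i + 1) ≫ t = app h (i + 1) - partialHomotopy h i ≫ X.d i then H.choose else 0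

/-- Usual inductive construction from the left: `h - φ d` is killed by the preceding differential,
hence factors through the next one. So the default value `0` in `partialHomotopy` is not used in the
degrees considered here; the construction says nothing about degree `n + 1`. -/
lemma partialHomotopy_spec (hX : X.IsComplex) (hX' : X.RightExact) (h : X ⟶ X)
    (h₀ : app h 0 = 0) (i : ℕ) (hi : i < n) :
    app h (i + 1) =
      partialHomotopy h i ≫ X.d i + X.d (i + 1) ≫ partialHomotopy h (i + 1) := by
  have key : ∀ j, j ≤ n → X.d j ≫ partialHomotopy h j ≫ X.d j = app h j ≫ X.d j →
      j < n → app h (j + 1) =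
        partialHomotopy h j ≫ X.d j + X.d (j + 1) ≫ partialHomotopy h (j + 1) := by
    intro j _ hj hjn
    have H := hX' j hjn (app h (j + 1) - partialHomotopy h j ≫ X.d j) (by
      rw [Preadditive.comp_sub, app_comm, hj, sub_self])
    rw [partialHomotopy, dif_pos H, H.choose_spec, add_sub_cancel]
  refine key i hi.le ?_ hi
  induction i with
  | zero => simp [partialHomotopy, h₀]
  | succ i ih =>
    have := key i (by omega) (ih (by omega)) (by omega)
    rw [this, Preadditive.add_comp, Category.assoc, hX i, comp_zero, zero_add, Category.assoc]

/-- An endomorphism which vanishes on the end terms has null-homotopic square. -/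
lemma exists_homotopy_sq (hX : X.IsComplex) (hX' : X.RightExact) (h : X ⟶ X)
    (h₀ : app h 0 = 0) (h₁ : app h (n + 1) = 0) :
    ∃ ψ : ∀ i : ℕ, X.obj (i + 1) ⟶ X.obj i, app h 0 ≫ app h 0 = X.d 0 ≫ ψ 0 ∧
      ∀ i : ℕ, app h (i + 1) ≫ app h (i + 1) = ψ i ≫ X.d i + X.d (i + 1) ≫ ψ (i + 1) := by
  -- Below the top degree, multiply the identity `h = φ d + d φ` by `h` and move `h` past `d`.
  refine ⟨fun i => partialHomotopy h i ≫ app h i, by simp [h₀], fun i => ?_⟩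
  rcases lt_trichotomy i n with hi | rfl | hi
  · have h₂ := partialHomotopy_spec hX hX' h h₀ i hi
    have h₃ : app h (i + 1) ≫ app h (i + 1) = (partialHomotopy h i ≫ X.d i +
        X.d (i + 1) ≫ partialHomotopy h (i + 1)) ≫ app h (i + 1) := congr($h₂ ≫ app h (i + 1))
    rw [h₃, Preadditive.add_comp, Category.assoc, Category.assoc, Category.assoc, app_comm]
  -- In the top degree the term `φ h d = φ d h` vanishes because `h` does; for `h` itself the term
  -- `φ d` could survive, which is why the square is taken.
  · have h₂ : X.d (i + 1) = 0 := (X.isZero (i + 2) (by omega)).eq_of_tgt _ _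
    rw [Category.assoc, ← app_comm, h₁, h₂]
    simp
  · exact (X.isZero (i + 1) (by omega)).eq_of_src _ _

/-- If `f : X ⟶ Y` and `g : Y ⟶ X` are mutually inverse on the end terms, then the composite of
`f` with `2g - gfg` is homotopic to the identity. -/
lemma homotopic_id (hX : X.IsComplex) (hX' : X.RightExact) {e e' : X ⟶ X}
    (h₀ : app e 0 = 𝟙 _) (h₁ : app e (n + 1) = 𝟙 _)
    (he : ∀ i, app e' i = app e i + app e i - app e i ≫ app e i) : Homotopic e' (𝟙 X) := by
  -- Indeed `1 - (2e - e²) = (1 - e)²`.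
  let h : X ⟶ X := homMk (fun i => 𝟙 _ - app e i) fun i => by
    simp [Preadditive.comp_sub, Preadditive.sub_comp, app_comm]
  have hh : ∀ i, app (𝟙 X) i - app e' i = app h i ≫ app h i := fun i => by
    simp only [h, app_homMk, app_id, he, Preadditive.comp_sub, Preadditive.sub_comp,
      Category.comp_id, Category.id_comp]
    abel
  obtain ⟨ψ, a, b⟩ := exists_homotopy_sq hX hX' h (by simp [h, h₀]) (by simp [h, h₁])
  exact ⟨ψ, by rw [hh, a], fun i => by rw [hh, b]⟩

end RightExact

end Seq

/-! ### Functoriality of extensions and composition of lifts -/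

section Ext

variable {𝒞 : Type u} [Category.{v} 𝒞] {E : 𝒞ᵒᵖ ⥤ 𝒞 ⥤ AddCommGrpCat.{w}}

lemma push_comp_apply {C A A' A'' : 𝒞} (a : A ⟶ A') (b : A' ⟶ A'') (δ : Ext E C A) :
    push (a ≫ b) δ = push b (push a δ) := by
  simp [push]

lemma pull_comp_apply {C C' C'' A : 𝒞} (c : C' ⟶ C) (b : C'' ⟶ C') (δ : Ext E C A) :
    pull (b ≫ c) δ = pull b (pull c δ) := by
  simp [pull]

lemma push_id_apply {C A : 𝒞} (δ : Ext E C A) : push (𝟙 A) δ = δ := by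
  simp [push]

lemma pull_id_apply {C A : 𝒞} (δ : Ext E C A) : pull (𝟙 C) δ = δ := by
  simp [pull]

lemma push_pull_comm {C C' A A' : 𝒞} (a : A ⟶ A') (c : C' ⟶ C) (δ : Ext E C A) :
    push a (pull c δ) = pull c (push a δ) :=
  congr(($((E.map c.op).naturality a)).hom δ).symm

end Ext

section Lift

variable {𝒞 : Type u} [Category.{v} 𝒞] {n : ℕ}

lemma IsLift.comp {A B C D A' C' : 𝒞} {X : EndSeq n A C} {Y : EndSeq n B D} {Z : EndSeq n A' C'}
    {a : A ⟶ B} {c : C ⟶ D} {a' : B ⟶ A'} {c' : D ⟶ C'}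
    {f : X.seq ⟶ Y.seq} {g : Y.seq ⟶ Z.seq} (hf : IsLift X Y a c f) (hg : IsLift Y Z a' c' g) :
    IsLift X Z (a ≫ a') (c ≫ c') (f ≫ g) := by
  obtain ⟨h₁, h₂⟩ := hf
  obtain ⟨h₃, h₄⟩ := hg
  constructor
  · rw [Seq.app_comp, Category.assoc, h₃, reassoc_of% h₁]
  · rw [Seq.app_comp, Category.assoc, h₄, reassoc_of% h₂]

lemma IsLift.app_zero {A C : 𝒞} {X : EndSeq n A C} {f : X.seq ⟶ X.seq}
    (hf : IsLift X X (𝟙 A) (𝟙 C) f) : Seq.app f 0 = 𝟙 _ := by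
  rw [← cancel_mono X.left.hom, hf.1, Category.comp_id, Category.id_comp]

lemma IsLift.app_last {A C : 𝒞} {X : EndSeq n A C} {f : X.seq ⟶ X.seq}
    (hf : IsLift X X (𝟙 A) (𝟙 C) f) : Seq.app f (n + 1) = 𝟙 _ := by
  rw [← cancel_mono X.right.hom, hf.2, Category.comp_id, Category.id_comp]

lemma isLift_app {X Y : Seq 𝒞 (n + 1)} (f : X ⟶ Y) :
    IsLift ⟨X, Iso.refl _, Iso.refl _⟩ ⟨Y, Iso.refl _, Iso.refl _⟩ (Seq.app f 0)
      (Seq.app f (n + 1)) f :=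
  ⟨(Category.comp_id _).trans (Category.id_comp _).symm,
    (Category.comp_id _).trans (Category.id_comp _).symm⟩

end Lift

/-! ### Recognizing realizations -/

section Recognition

variable {𝒞 : Type u} [Category.{v} 𝒞] [Preadditive 𝒞] {n : ℕ}

lemma htpyEquiv_of_lifts {A C : 𝒞} (X Y : EndComplex n A C) (hX : X.seq.RightExact)
    (hY : Y.seq.RightExact) (f : X.seq ⟶ Y.seq) (g : Y.seq ⟶ X.seq)
    (hf : IsLift X.toEndSeq Y.toEndSeq (𝟙 A) (𝟙 C) f)
    (hg : IsLift Y.toEndSeq X.toEndSeq (𝟙 A) (𝟙 C) g) : HtpyEquiv X Y := by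
  -- With `g' = 2g - gfg`, both `1 - fg'` and `1 - g'f` become squares of endomorphisms vanishing on
  -- the end terms, and `g'` still lifts the identities.
  let g' : Y.seq ⟶ X.seq :=
    Seq.homMk (fun i => Seq.app g i + Seq.app g i - Seq.app g i ≫ Seq.app f i ≫ Seq.app g i)
      fun i => by
        have h : Y.seq.d i ≫ Seq.app g (i + 1) ≫ Seq.app f (i + 1) ≫ Seq.app g (i + 1) =
            Seq.app g i ≫ Seq.app f i ≫ Seq.app g i ≫ X.seq.d i := by
          simpa [Seq.app_comp] using Seq.app_comm (g ≫ f ≫ g) i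
        simp only [Preadditive.comp_sub, Preadditive.sub_comp, Preadditive.comp_add,
          Preadditive.add_comp, Seq.app_comm, Category.assoc, h]
  have hfg := hf.comp_id hg
  have hgf := hg.comp_id hf
  have h₁ : ∀ i, Seq.app (f ≫ g') i = Seq.app (f ≫ g) i + Seq.app (f ≫ g) i -
      Seq.app (f ≫ g) i ≫ Seq.app (f ≫ g) i := fun i => by
    simp [g', Seq.app_comp]
  have h₂ : ∀ i, Seq.app (g' ≫ f) i = Seq.app (g ≫ f) i + Seq.app (g ≫ f) i -
      Seq.app (g ≫ f) i ≫ Seq.app (g ≫ f) i := fun i => by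
    simp [g', Seq.app_comp]
  refine ⟨f, g', hf, ⟨?_, ?_⟩,
    Seq.homotopic_id X.isComplex hX hfg.app_zero hfg.app_last h₁,
    Seq.homotopic_id Y.isComplex hY hgf.app_zero hgf.app_last h₂⟩
  · simp [g', hf.1, hg.1]
  · simp [g', hf.2, hg.2]

variable {E : 𝒞ᵒᵖ ⥤ 𝒞 ⥤ AddCommGrpCat.{w}} {s : Realization E n}

namespace Realization

lemma exists_realizes (s : Realization E n) {A C : 𝒞} (δ : Ext E C A) :
    ∃ X : EndSeq n A C, s.Realizes δ X := by
  obtain ⟨X, hX⟩ := Quotient.exists_rep (s.cls δ)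
  exact ⟨X.toEndSeq, X.isComplex, hX.symm⟩

lemma Realizes.exists_lift {A B C D : 𝒞} {δ : Ext E C A} {ρ : Ext E D B} {X : EndSeq n A C}
    {Y : EndSeq n B D} (hX : s.Realizes δ X) (hY : s.Realizes ρ Y) (a : A ⟶ B) (c : C ⟶ D)
    (h : push a δ = pull c ρ) : ∃ f : X.seq ⟶ Y.seq, IsLift X Y a c f := by
  obtain ⟨_, hX⟩ := hX
  obtain ⟨_, hY⟩ := hY
  exact s.exists_lift δ ρ a c h _ _ hX hY

variable [HasZeroObject 𝒞] [NeZero n]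

lemma IsExact.rightExact (hs : s.IsExact) {A C : 𝒞} {δ : Ext E C A} {X : EndSeq n A C}
    (hX : s.Realizes δ X) : X.seq.RightExact := fun Q i hi g hg =>
  ((hs.isExangle δ X hX).exact_right Q i hi g).1 hg

/-- A right exact complex realizes an extension if it admits morphisms from and to some
realization of it which are the identity on the end terms. -/
lemma IsExact.realizes_of_lifts (hs : s.IsExact) {A C : 𝒞} {δ : Ext E C A} {X Y : EndSeq n A C}
    (hX : s.Realizes δ X) (hY : Y.seq.IsComplex) (hY' : Y.seq.RightExact)
    (h₁ : ∃ f, IsLift X Y (𝟙 A) (𝟙 C) f) (h₂ : ∃ g, IsLift Y X (𝟙 A) (𝟙 C) g) :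
    s.Realizes δ Y := by
  have hX' := hs.rightExact hX
  obtain ⟨hXc, hX⟩ := hX
  obtain ⟨f, hf⟩ := h₁
  obtain ⟨g, hg⟩ := h₂
  refine ⟨hY, hX.trans (Quotient.sound ?_)⟩
  exact htpyEquiv_of_lifts ⟨X, hXc⟩ ⟨Y, hY⟩ hX' hY' f g hf hg

/-- Compare `Y` with an arbitrary realization `Z` of `ρ`: the compatibilities `h₁` and `h₂` give
lifts between `Z` and `X`, and composing with `π` and `ι` gives lifts of the identities between `Z`
and `Y`. Being a complex and right exactness pass to retracts. -/
lemma IsExact.realizes_of_retract (hs : s.IsExact) {A B C D : 𝒞} {δ : Ext E C A} {ρ : Ext E D B}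
    {X : EndSeq n A C} {Y : EndSeq n B D} (hX : s.Realizes δ X)
    {a : B ⟶ A} {c : D ⟶ C} {a' : A ⟶ B} {c' : C ⟶ D} (ι : Y.seq ⟶ X.seq) (π : X.seq ⟶ Y.seq)
    (hι : IsLift Y X a c ι) (hπ : IsLift X Y a' c' π) (h : ι ≫ π = 𝟙 Y.seq)
    (h₁ : push a ρ = pull c δ) (h₂ : push a' δ = pull c' ρ) : s.Realizes ρ Y := by
  obtain ⟨Z, hZ⟩ := s.exists_realizes ρ
  have h₃ := hι.comp hπ
  -- The end components of `ι ≫ π = 𝟙` force the maps on the end terms to compose to identities.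
  have ha : a ≫ a' = 𝟙 B := by
    have := h₃.1
    rw [h, Seq.app_id, Category.id_comp] at this
    rw [← cancel_epi Y.left.hom, ← this, Category.comp_id]
  have hc : c ≫ c' = 𝟙 D := by
    have := h₃.2
    rw [h, Seq.app_id, Category.id_comp] at this
    rw [← cancel_epi Y.right.hom, ← this, Category.comp_id]
  obtain ⟨f, hf⟩ := hZ.exists_lift hX a c h₁
  obtain ⟨g, hg⟩ := hX.exists_lift hZ a' c' h₂
  refine hs.realizes_of_lifts hZ (hX.1.of_retract ι π h) ((hs.rightExact hX).of_retract ι π h)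
    ⟨f ≫ π, ?_⟩ ⟨ι ≫ g, ?_⟩
  · rw [← ha, ← hc]; exact hf.comp hπ
  · rw [← ha, ← hc]; exact hι.comp hg

lemma IsExact.realizes_of_iso (hs : s.IsExact) {A B C D : 𝒞} {δ : Ext E C A} {ρ : Ext E D B}
    {X : EndSeq n A C} {Y : EndSeq n B D} (hX : s.Realizes δ X) (a : A ≅ B) (c : C ≅ D)
    (e : X.seq ≅ Y.seq) (he : IsLift X Y a.hom c.hom e.hom)
    (h : push a.hom δ = pull c.hom ρ) : s.Realizes ρ Y := by
  refine hs.realizes_of_retract hX (a := a.inv) (c := c.inv) e.inv e.hom ⟨?_, ?_⟩ he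
    e.inv_hom_id ?_ h
  · have h₀ : Seq.app e.inv 0 ≫ Seq.app e.hom 0 = 𝟙 _ := by
      rw [← Seq.app_comp, e.inv_hom_id, Seq.app_id]
    rw [Iso.eq_comp_inv, Category.assoc, ← he.1, reassoc_of% h₀]
  · have h₀ : Seq.app e.inv (n + 1) ≫ Seq.app e.hom (n + 1) = 𝟙 _ := by
      rw [← Seq.app_comp, e.inv_hom_id, Seq.app_id]
    rw [Iso.eq_comp_inv, Category.assoc, ← he.2, reassoc_of% h₀]
  · have := congrArg (fun x => pull c.inv (push a.inv x)) h
    simp only [push_pull_comm, ← push_comp_apply, ← pull_comp_apply, Iso.hom_inv_id,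
      Iso.inv_hom_id, push_id_apply, pull_id_apply] at this
    exact this.symm

end Realization

end Recognition

/-! ### Isomorphisms up to sign and the components of mapping cones -/

section Iso

variable {𝒞 : Type u} [Category.{v} 𝒞] [Preadditive 𝒞]

lemma isIso_neg_one_pow_zsmul (k : ℕ) {A B : 𝒞} (f : A ⟶ B) [IsIso f] :
    IsIso ((-1 : ℤ) ^ k • f) := by
  refine ⟨(-1 : ℤ) ^ k • inv f, ?_, ?_⟩ <;>
  simp [smul_smul, ← mul_pow]

variable [HasBinaryBiproducts 𝒞]

lemma isIso_biprod_fst {A B : 𝒞} (hB : IsZero B) : IsIso (biprod.fst : A ⊞ B ⟶ A) :=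
  ⟨biprod.inl, by
    apply biprod.hom_ext
    · simp
    · exact hB.eq_of_tgt _ _, biprod.inl_fst⟩

lemma isIso_biprod_snd {A B : 𝒞} (hA : IsZero A) : IsIso (biprod.snd : A ⊞ B ⟶ B) :=
  ⟨biprod.inr, by
    apply biprod.hom_ext
    · exact hA.eq_of_tgt _ _
    · simp, biprod.inr_snd⟩

lemma isIso_biprod_map {A B C D : 𝒞} (p : A ⟶ C) (q : B ⟶ D) [IsIso p] [IsIso q] :
    IsIso (biprod.map p q) :=
  (biprod.mapIso (asIso p) (asIso q)).isIso_hom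

end Iso

namespace Seq

section Cone

variable {𝒞 : Type u} [Category.{v} 𝒞] [Preadditive 𝒞] [HasBinaryBiproducts 𝒞] {n : ℕ}
  {X Y : Seq 𝒞 (n + 1)}

/-- The projection of the terms of the mapping cone to those of the source. -/
noncomputable def coneFst (X Y : Seq 𝒞 (n + 1)) : ∀ i, coneObj X Y i ⟶ X.obj (i + 1)
  | 0 => 𝟙 _
  | _ + 1 => biprod.fst

/-- The projection of the terms of the mapping cone to those of the target. -/
noncomputable def coneSnd (X Y : Seq 𝒞 (n + 1)) : ∀ i, coneObj X Y i ⟶ Y.obj i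
  | 0 => 0
  | _ + 1 => biprod.snd

lemma coneD_fst (f : X ⟶ Y) (i : ℕ) :
    coneD f i ≫ coneFst X Y (i + 1) = -coneFst X Y i ≫ X.d (i + 1) := by
  cases i with
  | zero =>
    have h {A B C : 𝒞} (d : A ⟶ B) (g : A ⟶ C) :
      biprod.lift (-d) g ≫ biprod.fst = -𝟙 A ≫ d := by simp
    exact h (X.d 1) (app f 1)
  | succ i =>
    have h {A B C D : 𝒞} (d : A ⟶ C) (g : A ⟶ D) (e : B ⟶ D) :
        Biprod.ofComponents (-d) g 0 e ≫ biprod.fst = -biprod.fst ≫ d := by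
      apply biprod.hom_ext' <;> simp
    exact h (X.d (i + 2)) (app f (i + 2)) (Y.d (i + 1))

lemma coneD_snd (f : X ⟶ Y) (i : ℕ) :
    coneD f i ≫ coneSnd X Y (i + 1) =
      coneFst X Y i ≫ app f (i + 1) + coneSnd X Y i ≫ Y.d i := by
  cases i with
  | zero =>
    have h {A B C D : 𝒞} (d : A ⟶ B) (g : A ⟶ C) (e : D ⟶ C) :
      biprod.lift (-d) g ≫ biprod.snd = 𝟙 A ≫ g + 0 ≫ e := by simp
    exact h (X.d 1) (app f 1) (Y.d 0)
  | succ i =>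
    have h {A B C D : 𝒞} (d : A ⟶ C) (g : A ⟶ D) (e : B ⟶ D) :
        Biprod.ofComponents (-d) g 0 e ≫ biprod.snd = biprod.fst ≫ g + biprod.snd ≫ e := by
      apply biprod.hom_ext' <;> simp
    exact h (X.d (i + 2)) (app f (i + 2)) (Y.d (i + 1))

lemma coneLast_eq (f : X ⟶ Y) (i : ℕ) :
    coneLast f i = coneFst X Y i ≫ app f (i + 1) + coneSnd X Y i ≫ Y.d i := by
  cases i with
  | zero =>
    have h {A C D : 𝒞} (g : A ⟶ C) (e : D ⟶ C) : g = 𝟙 A ≫ g + 0 ≫ e := by simp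
    exact h (app f 1) (Y.d 0)
  | succ i =>
    have h {A B D : 𝒞} (g : A ⟶ D) (e : B ⟶ D) :
        biprod.desc g e = biprod.fst ≫ g + biprod.snd ≫ e := by
      apply biprod.hom_ext' <;> simp
    exact h (app f (i + 2)) (Y.d (i + 1))

end Cone

end Seq

section Additive

variable {𝒞 : Type u} [Category.{v} 𝒞] [Preadditive 𝒞] {S : 𝒞 ⥤ 𝒞}

/-- The pushforward of `𝟙 (S A)` along `a` is `S a`, so biadditivity in the second variable is
additivity of `S`. -/
lemma IsBiadditive.additive (h : IsBiadditive (homShift S)) : S.Additive where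
  map_add {A B a b} := by
    have := h.push_add a b (toExt (𝟙 (S.obj A)))
    simp only [push_toExt, Category.id_comp] at this
    exact this

end Additive

/-! ### The sequence `A → 0 → ⋯ → 0 → S A` -/

namespace SigmaSeq

variable {𝒞 : Type u} [Category.{v} 𝒞] [Preadditive 𝒞] [HasZeroObject 𝒞] (S : 𝒞 ⥤ 𝒞) (n : ℕ)

section OfSnoc

variable {S n} (K : ℕ → 𝒞) (dK : ∀ i, K i ⟶ K (i + 1)) {Z : 𝒞} (f : K n ⟶ Z)
  (e : Z ⟶ S.obj (K 0))

/-- The terms of degree at most `n` of `SigmaSeq.ofSnoc`. -/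
noncomputable def ofSnocIso (i : ℕ) (hi : i ≤ n) : (ofSnoc K dK f e).seq.obj i ≅ K i :=
  Seq.snocIso K dK n f i hi

/-- The term of degree `n + 1` of `SigmaSeq.ofSnoc`. -/
noncomputable def ofSnocLastIso : (ofSnoc K dK f e).seq.obj (n + 1) ≅ Z :=
  Seq.snocLastIso K dK n f

lemma ofSnoc_conn : (ofSnoc K dK f e).conn =
    (ofSnocLastIso K dK f e).hom ≫ e ≫ S.map (ofSnocIso K dK f e 0 (Nat.zero_le n)).inv := rfl

lemma ofSnoc_d (i : ℕ) (hi : i < n) : (ofSnoc K dK f e).seq.d i =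
    (ofSnocIso K dK f e i hi.le).hom ≫ dK i ≫ (ofSnocIso K dK f e (i + 1) hi).inv :=
  Seq.snoc_d' i hi

lemma ofSnoc_d_last : (ofSnoc K dK f e).seq.d n =
    (ofSnocIso K dK f e n le_rfl).hom ≫ f ≫ (ofSnocLastIso K dK f e).inv :=
  Seq.snoc_d_last'

end OfSnoc

/-- The terms of `A ⟶ 0 ⟶ ⋯ ⟶ 0`. -/
noncomputable abbrev shiftObj (A : 𝒞) : ℕ → 𝒞
  | 0 => A
  | _ + 1 => 0

/-- The sequence `A ⟶ 0 ⟶ ⋯ ⟶ 0 ⟶ S A ⟶ S A` with last morphism `𝟙`. -/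
noncomputable def shift (A : 𝒞) : SigmaSeq S n :=
  ofSnoc (shiftObj A) (fun _ => 0) (Z := S.obj A) 0 (𝟙 (S.obj A))

/-- The initial term of `SigmaSeq.shift`. -/
noncomputable def shiftLeft (A : 𝒞) : (shift S n A).seq.obj 0 ≅ A :=
  Seq.snocIso _ _ n _ 0 (Nat.zero_le n)

/-- The final term of `SigmaSeq.shift`. -/
noncomputable def shiftRight (A : 𝒞) : (shift S n A).seq.obj (n + 1) ≅ S.obj A :=
  Seq.snocLastIso _ _ n _

/-- The sequence `A ⟶ 0 ⟶ ⋯ ⟶ 0 ⟶ S A` with end terms `A` and `S A`. -/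
noncomputable abbrev shiftEnd (A : 𝒞) : EndSeq n A (S.obj A) where
  seq := (shift S n A).seq
  left := shiftLeft S n A
  right := shiftRight S n A

lemma shift_conn (A : 𝒞) :
    (shift S n A).conn = (shiftRight S n A).hom ≫ S.map (shiftLeft S n A).inv := 
  congrArg (_ ≫ ·) (Category.id_comp _)

lemma isZero_shift (A : 𝒞) (i : ℕ) (h₀ : i ≠ 0) (hi : i ≤ n) :
    IsZero ((shift S n A).seq.obj i) := by
  obtain ⟨j, rfl⟩ := Nat.exists_eq_succ_of_ne_zero h₀
  exact (isZero_zero 𝒞).of_iso (Seq.snocIso (shiftObj A) (fun _ => 0) n (Z := S.obj A) 0 _ hi)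

lemma exists_toShift {A : 𝒞} {X : Seq 𝒞 (n + 1)} (α : X.obj 0 ⟶ A) (β : X.obj (n + 1) ⟶ S.obj A)
    (h : X.d n ≫ β = 0) : ∃ f : X ⟶ (shift S n A).seq,
      Seq.app f 0 ≫ (shiftLeft S n A).hom = α ∧ Seq.app f (n + 1) ≫ (shiftRight S n A).hom = β := by
  refine ⟨Seq.toSnoc (fun i _ => match i with
    | 0 => α
    | _ + 1 => 0) β (fun i hi => comp_zero.trans comp_zero.symm) (h.trans comp_zero.symm),
    (Iso.eq_comp_inv _).1 (Seq.app_toSnoc _ _ _ _ 0 (Nat.zero_le n)),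
    (Iso.eq_comp_inv _).1 (Seq.app_toSnoc_last _ _ _ _)⟩

lemma exists_fromShift {A : 𝒞} {X : Seq 𝒞 (n + 1)} (α : A ⟶ X.obj 0) (β : S.obj A ⟶ X.obj (n + 1))
    (h : α ≫ X.d 0 = 0) : ∃ f : (shift S n A).seq ⟶ X,
      Seq.app f 0 = (shiftLeft S n A).hom ≫ α ∧ Seq.app f (n + 1) = (shiftRight S n A).hom ≫ β := by
  let a : ∀ i, shiftObj A i ⟶ X.obj i
    | 0 => α
    | _ + 1 => 0
  have ha : ∀ i, a i ≫ X.d i = 0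
    | 0 => h
    | _ + 1 => zero_comp
  exact ⟨Seq.fromSnoc (fun i _ => a i) β (fun i hi => zero_comp.trans (ha i).symm)
    (zero_comp.trans (ha n).symm), Seq.app_fromSnoc _ _ _ _ 0 (Nat.zero_le n),
    Seq.app_fromSnoc_last _ _ _ _⟩

lemma isComplex_shift (A : 𝒞) : (shift S n A).seq.IsComplex := fun i => by
  by_cases hi : i + 1 ≤ n
  · rw [(isZero_shift S n A (i + 1) (by omega) hi).eq_of_tgt ((shift S n A).seq.d i) 0, zero_comp]
  · exact ((shift S n A).seq.isZero (i + 1 + 1) (by omega)).eq_of_tgt _ _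

lemma rightExact_shift (A : 𝒞) : (shift S n A).seq.RightExact := fun _ i hi _ _ =>
  ⟨0, (isZero_shift S n A (i + 1) (by omega) hi).eq_of_src _ _⟩

end SigmaSeq

/-! ### Realizing identities, and transport from cones and cocones -/

namespace Realization

open SigmaSeq

variable {𝒞 : Type u} [Category.{v} 𝒞] [Preadditive 𝒞] [HasZeroObject 𝒞] {S : 𝒞 ⥤ 𝒞} {n : ℕ}
  [NeZero n] {s : Realization (homShift S) n}

lemma IsExact.mem_angles (hs : s.IsExact) {A C : 𝒞} {δ : C ⟶ S.obj A} {X : EndSeq n A C}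
    (hX : s.Realizes (toExt δ) X) {Y : SigmaSeq S n} (e : X.seq ⟶ Y.seq)
    (he : ∀ i, IsIso (Seq.app e i))
    (h : X.right.hom ≫ δ ≫ S.map (X.left.inv ≫ Seq.app e 0) = Seq.app e (n + 1) ≫ Y.conn) :
    Y ∈ s.angles := by
  have := he 0
  have := he (n + 1)
  refine hs.realizes_of_iso hX (X.left.symm ≪≫ asIso (Seq.app e 0))
    (X.right.symm ≪≫ asIso (Seq.app e (n + 1))) (Seq.isoOfApp e he) ⟨?_, ?_⟩ ?_
  · simp [Seq.isoOfApp]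
  · simp [Seq.isoOfApp]
  · rw [push_toExt, pull_toExt]
    congr 1
    simp only [Iso.trans_hom, Iso.symm_hom, asIso_hom, Category.assoc]
    rw [← h, Iso.inv_hom_id_assoc]

lemma IsExact.realizes_of_mem (hs : s.IsExact) {X : SigmaSeq S n} (hX : X ∈ s.angles) {A C : 𝒞}
    (l : X.seq.obj 0 ≅ A) (r : X.seq.obj (n + 1) ≅ C) {δ : C ⟶ S.obj A}
    (h : X.conn ≫ S.map l.hom = r.hom ≫ δ) :
    s.Realizes (toExt δ) ⟨X.seq, l, r⟩ :=
  hs.realizes_of_iso hX l r (Iso.refl _) ⟨by simp [Seq.app_id], by simp [Seq.app_id]⟩ (by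
    rw [push_toExt, pull_toExt, h])

/-- In any realization `X` the outer differentials vanish, so the identifications of the end terms
extend by zero to morphisms in both directions. -/
lemma IsExact.realizes_shiftEnd [S.IsEquivalence] (hs : s.IsExact) (A : 𝒞) :
    s.Realizes (toExt (𝟙 (S.obj A))) (shiftEnd S n A) := by
  obtain ⟨X, hX⟩ := s.exists_realizes (toExt (𝟙 (S.obj A)))
  have hE := hs.isExangle _ X hX
  rw [push_toExt, pull_toExt, Category.id_comp] at hE
  -- The last differential pulls the extension back to zero, and here the extension is an
  -- isomorphism.
  have hl : X.seq.d n = 0 := by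
    have h : X.seq.d n ≫ X.right.hom ≫ S.map X.left.inv = 0 :=
      (hE.exact_left_last (X.seq.obj n) (X.seq.d n)).2 ⟨𝟙 _, Category.id_comp _⟩
    rwa [← cancel_mono (X.right.hom ≫ S.map X.left.inv), zero_comp]
  -- Dually, the extension followed by `S d⁰` is zero; faithfulness of `S` gives `d⁰ = 0`.
  have hr : X.seq.d 0 = 0 := by
    have h : (X.right.hom ≫ S.map X.left.inv) ≫ S.map (X.seq.d 0) = 0 :=
      (hE.exact_right_last (X.seq.obj 1) (X.seq.d 0)).2 ⟨𝟙 _, Category.comp_id _⟩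
    apply S.map_injective
    rwa [S.map_zero, ← cancel_epi (X.right.hom ≫ S.map X.left.inv), comp_zero]
  obtain ⟨f, hf⟩ := exists_toShift S n X.left.hom X.right.hom (by rw [hl, zero_comp])
  obtain ⟨g, hg⟩ := exists_fromShift S n X.left.inv X.right.inv (by rw [hr, comp_zero])
  exact hs.realizes_of_lifts hX (isComplex_shift S n A) (rightExact_shift S n A)
    ⟨f, by simp [IsLift, hf]⟩ ⟨g, by simp [IsLift, hg]⟩

lemma IsExact.shift_mem [S.IsEquivalence] (hs : s.IsExact) (A : 𝒞) :
    shift S n A ∈ s.angles :=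
  hs.mem_angles (hs.realizes_shiftEnd A) (𝟙 (shift S n A).seq)
    (fun i => by rw [Seq.app_id]; infer_instance) (by
    rw [Seq.app_id, Seq.app_id, shift_conn]
    simp [shiftEnd])

section Cone

variable [HasBinaryBiproducts 𝒞] {A B C D : 𝒞} {X : EndSeq n A C} {Y : EndSeq n B D}
  {f : X.seq ⟶ Y.seq}

/-- Common to left rotation and the cone axiom, where the mapping cone is identified with the
desired sequence by `α` and `β`. The morphism `α₀` is `α 0` with its source written as `X¹`, the
object occurring in `δ`. -/
lemma IsExact.ofSnoc_mem_angles_of_cone (hs : s.IsExact) {δ : D ⟶ S.obj (X.seq.obj 1)}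
    (h : s.Realizes (toExt δ) (EndSeq.cone (X := X) (Y := Y) f)) {K : ℕ → 𝒞}
    {dK : ∀ i, K i ⟶ K (i + 1)} {Z : 𝒞} {l : K n ⟶ Z} {e : Z ⟶ S.obj (K 0)}
    (α : ∀ i, Seq.coneObj X.seq Y.seq i ⟶ K i) (β : D ⟶ Z)
    (hα : ∀ i, i < n → Seq.coneD f i ≫ α (i + 1) = α i ≫ dK i)
    (hβ : Seq.coneLast f n ≫ Y.right.hom ≫ β = α n ≫ l)
    (hα' : ∀ i, i ≤ n → IsIso (α i)) (hβ' : IsIso β) (α₀ : X.seq.obj 1 ⟶ K 0) (hα₀ : α 0 = α₀)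
    (he : δ ≫ S.map α₀ = β ≫ e) :
    ofSnoc K dK l e ∈ s.angles := by
  let φ : (EndSeq.cone (X := X) (Y := Y) f).seq ⟶ (ofSnoc K dK l e).seq :=
    Seq.fromSnoc (fun i hi => α i ≫ (ofSnocIso K dK l e i hi).inv)
      (Y.right.hom ≫ β ≫ (ofSnocLastIso K dK l e).inv)
      (fun i hi => by rw [ofSnoc_d _ _ _ _ _ hi, reassoc_of% (hα i hi)]; simp)
      (by rw [ofSnoc_d_last, reassoc_of% hβ]; simp)
  have h₁ : (EndSeq.cone (X := X) (Y := Y) f).left.inv ≫ Seq.app φ 0 =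
      α₀ ≫ (ofSnocIso K dK l e 0 (Nat.zero_le n)).inv := by
    rw [Iso.inv_comp_eq]
    subst hα₀
    exact Seq.app_fromSnoc _ _ _ _ 0 (Nat.zero_le n)
  have h₂ : Seq.app φ (n + 1) = (EndSeq.cone (X := X) (Y := Y) f).right.hom ≫ β ≫
      (ofSnocLastIso K dK l e).inv :=
    (Seq.app_fromSnoc_last _ _ _ _).trans (Category.assoc _ _ _).symm
  refine hs.mem_angles h φ (Seq.isIso_app_fromSnoc _ _ _ _ (fun i hi => ?_) ?_) ?_
  · have := hα' i hi
    infer_instance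
  · infer_instance
  · rw [h₁, h₂, ofSnoc_conn, S.map_comp, reassoc_of% he]
    simp

lemma IsExact.mem_angles_of_cocone (hs : s.IsExact) {δ : Y.seq.obj n ⟶ S.obj A}
    (h : s.Realizes (toExt δ) (EndSeq.cocone (X := X) (Y := Y) f)) {T : SigmaSeq S n}
    (α : ∀ i, i ≤ n → (Seq.coconeObj X.seq Y.seq i ⟶ T.seq.obj i))
    (β : Y.seq.obj n ⟶ T.seq.obj (n + 1))
    (hα : ∀ i (hi : i < n), Seq.coconeD f i ≫ α (i + 1) hi = α i hi.le ≫ T.seq.d i)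
    (hβ : Seq.coconeLast f n ≫ β = α n le_rfl ≫ T.seq.d n)
    (hα' : ∀ i (hi : i ≤ n), IsIso (α i hi)) (hβ' : IsIso β) (α₀ : A ⟶ T.seq.obj 0)
    (hα₀ : α 0 (Nat.zero_le n) = X.left.hom ≫ α₀)
    (he : δ ≫ S.map α₀ = β ≫ T.conn) :
    T ∈ s.angles := by
  let φ : (EndSeq.cocone (X := X) (Y := Y) f).seq ⟶ T.seq := Seq.fromSnoc α β hα hβ
  have h₁ : (EndSeq.cocone (X := X) (Y := Y) f).left.inv ≫ Seq.app φ 0 = α₀ := by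
    rw [Iso.inv_comp_eq]
    exact (Seq.app_fromSnoc _ _ _ _ 0 (Nat.zero_le n)).trans
      ((congrArg (_ ≫ ·) hα₀).trans (Category.assoc _ _ _).symm)
  have h₂ : Seq.app φ (n + 1) = (EndSeq.cocone (X := X) (Y := Y) f).right.hom ≫ β :=
    Seq.app_fromSnoc_last _ _ _ _
  refine hs.mem_angles h φ (Seq.isIso_app_fromSnoc _ _ _ _ hα' hβ') ?_
  rw [h₁, h₂, he, Category.assoc]

end Cone

end Realization

/-! ### Components of mapping cocones -/

namespace Seq

section Cone

variable {𝒞 : Type u} [Category.{v} 𝒞] [Preadditive 𝒞] {n : ℕ} {X Y : Seq 𝒞 (n + 1)}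

/-- The sum of two morphisms of sequences. -/
def homAdd (f g : X ⟶ Y) : X ⟶ Y :=
  homMk (fun i => app f i + app g i) fun i => by
    rw [Preadditive.comp_add, Preadditive.add_comp, app_comm, app_comm]

variable [HasBinaryBiproducts 𝒞]

lemma isIso_coneFst (i : ℕ) (h : i ≠ 0 → IsZero (Y.obj i)) : IsIso (coneFst X Y i) := by
  cases i with
  | zero => exact IsIso.id (X.obj 1)
  | succ i => exact isIso_biprod_fst (h (by omega))

/-- The initial term of the mapping cocone. -/
noncomputable def coconeZero (X Y : Seq 𝒞 (n + 1)) : coconeObj X Y 0 ≅ X.obj 0 := Iso.refl _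

/-- The projection of the terms of the mapping cocone to those of the target. -/
noncomputable def coconeSnd (X Y : Seq 𝒞 (n + 1)) (i : ℕ) : coconeObj X Y (i + 1) ⟶ Y.obj i :=
  biprod.snd

lemma coconeD_zero_snd (f : X ⟶ Y) :
    coconeD f 0 ≫ coconeSnd X Y 0 = (coconeZero X Y).hom ≫ app f 0 :=
  (biprod.lift_snd (X.d 0) (app f 0)).trans (Category.id_comp (app f 0)).symm

lemma coconeD_succ_snd (f : X ⟶ Y) (i : ℕ) (h : IsZero (X.obj (i + 1))) :
    coconeD f (i + 1) ≫ coconeSnd X Y (i + 1) = -coconeSnd X Y i ≫ Y.d i := by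
  have h' {A B C D : 𝒞} (hA : IsZero A) (d : A ⟶ C) (g : A ⟶ D) (e : B ⟶ D) :
      Biprod.ofComponents d g 0 (-e) ≫ biprod.snd = -biprod.snd ≫ e := by
    apply biprod.hom_ext'
    · exact hA.eq_of_src _ _
    · simp
  exact h' h (X.d (i + 1)) (app f (i + 1)) (Y.d i)

lemma coconeLast_succ (f : X ⟶ Y) (i : ℕ) (h : IsZero (X.obj (i + 1))) :
    coconeLast f (i + 1) = -coconeSnd X Y i ≫ Y.d i := by
  have h' {A B D : 𝒞} (hA : IsZero A) (g : A ⟶ D) (e : B ⟶ D) :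
      biprod.desc g (-e) = -biprod.snd ≫ e := by
    apply biprod.hom_ext'
    · exact hA.eq_of_src _ _
    · simp
  exact h' h (app f (i + 1)) (Y.d i)

lemma isIso_coconeSnd (i : ℕ) (h : IsZero (X.obj (i + 1))) : IsIso (coconeSnd X Y i) :=
  isIso_biprod_snd h

end Cone

end Seq

/-! ### Connecting morphisms of direct sums -/

namespace SigmaSeq

variable {𝒞 : Type u} [Category.{v} 𝒞] [Preadditive 𝒞] [HasBinaryBiproducts 𝒞] {S : 𝒞 ⥤ 𝒞}
  {n : ℕ} (X Y : SigmaSeq S n)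

/-- The connecting morphism of the direct sum of two `S`-sequences. -/
noncomputable def biprodConn :
    (X.seq.biprod Y.seq).obj (n + 1) ⟶ S.obj ((X.seq.biprod Y.seq).obj 0) :=
  (X.biprod Y).conn

lemma inl_biprodConn : Seq.app (Seq.biprodInl X.seq Y.seq) (n + 1) ≫ biprodConn X Y =
    X.conn ≫ S.map (Seq.app (Seq.biprodInl X.seq Y.seq) 0) :=
  biprod.inl_desc (X.conn ≫ S.map biprod.inl) (Y.conn ≫ S.map biprod.inr)

lemma inr_biprodConn : Seq.app (Seq.biprodInr X.seq Y.seq) (n + 1) ≫ biprodConn X Y =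
    Y.conn ≫ S.map (Seq.app (Seq.biprodInr X.seq Y.seq) 0) :=
  biprod.inr_desc (X.conn ≫ S.map biprod.inl) (Y.conn ≫ S.map biprod.inr)

variable [S.PreservesZeroMorphisms]

lemma biprodConn_fst : biprodConn X Y ≫ S.map (Seq.app (Seq.biprodFst X.seq Y.seq) 0) =
    Seq.app (Seq.biprodFst X.seq Y.seq) (n + 1) ≫ X.conn := by
  refine Seq.biprod_hom_ext' ?_ ?_
  · rw [← Category.assoc, ← Category.assoc, inl_biprodConn, Category.assoc, ← S.map_comp,
      Seq.app_biprodInl_fst, Seq.app_biprodInl_fst, S.map_id,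
      Category.comp_id, Category.id_comp]
  · rw [← Category.assoc, ← Category.assoc, inr_biprodConn, Category.assoc, ← S.map_comp,
      Seq.app_biprodInr_fst, Seq.app_biprodInr_fst, S.map_zero,
      comp_zero, zero_comp]

lemma biprodConn_snd : biprodConn X Y ≫ S.map (Seq.app (Seq.biprodSnd X.seq Y.seq) 0) =
    Seq.app (Seq.biprodSnd X.seq Y.seq) (n + 1) ≫ Y.conn := by
  refine Seq.biprod_hom_ext' ?_ ?_
  · rw [← Category.assoc, ← Category.assoc, inl_biprodConn, Category.assoc, ← S.map_comp,
      Seq.app_biprodInl_snd, Seq.app_biprodInl_snd, S.map_zero,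
      comp_zero, zero_comp]
  · rw [← Category.assoc, ← Category.assoc, inr_biprodConn, Category.assoc, ← S.map_comp,
      Seq.app_biprodInr_snd, Seq.app_biprodInr_snd, S.map_id,
      Category.comp_id, Category.id_comp]

end SigmaSeq

/-! ### Isomorphisms, direct sums, rotation, and extension of squares -/

namespace Realization

open SigmaSeq

variable {𝒞 : Type u} [Category.{v} 𝒞] [Preadditive 𝒞] [HasZeroObject 𝒞] {S : 𝒞 ⥤ 𝒞} {n : ℕ}
  [NeZero n] {s : Realization (homShift S) n}

lemma IsExact.mem_angles_of_isIso (hs : s.IsExact) {X Y : SigmaSeq S n} (e : X ≅ Y)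
    (hX : X ∈ s.angles) : Y ∈ s.angles := by
  refine hs.mem_angles hX (toSeqHom e.hom) (fun i => ?_) ?_
  · refine ⟨Seq.app (toSeqHom e.inv) i, ?_, ?_⟩
    · exact congr(Seq.app (toSeqHom $(e.hom_inv_id)) i)
    · exact congr(Seq.app (toSeqHom $(e.inv_hom_id)) i)
  · rw [Iso.refl_hom, Iso.refl_inv, Category.id_comp, Category.id_comp]
    exact e.hom.comm

lemma IsExact.triv_mem (hs : s.IsExact) (A : 𝒞) : SigmaSeq.triv A ∈ s.angles := by
  have h : s.Realizes (toExt (0 : 0 ⟶ S.obj A)) (EndSeq.trivLeft n A) := hs.realizes_trivLeft A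
  refine hs.mem_angles (Y := SigmaSeq.triv A) h (𝟙 (Seq.trivLeft A n))
    (fun i => IsIso.id ((Seq.trivLeft A n).obj i)) ?_
  rw [zero_comp, comp_zero]
  exact comp_zero.symm

section Biprod

variable [HasBinaryBiproducts 𝒞] [S.PreservesZeroMorphisms]

lemma IsExact.left_mem_of_biprod_mem (hs : s.IsExact) {X Y : SigmaSeq S n}
    (h : X.biprod Y ∈ s.angles) : X ∈ s.angles := by
  have h' : s.Realizes (toExt (biprodConn X Y)) ⟨X.seq.biprod Y.seq, Iso.refl _, Iso.refl _⟩ := h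
  refine hs.realizes_of_retract h' (Y := ⟨X.seq, Iso.refl _, Iso.refl _⟩)
    (Seq.biprodInl X.seq Y.seq) (Seq.biprodFst X.seq Y.seq)
    (a := Seq.app (Seq.biprodInl X.seq Y.seq) 0) (c := Seq.app (Seq.biprodInl X.seq Y.seq) (n + 1))
    (a' := Seq.app (Seq.biprodFst X.seq Y.seq) 0)
    (c' := Seq.app (Seq.biprodFst X.seq Y.seq) (n + 1))
    (isLift_app _) (isLift_app _) (Seq.biprodInl_fst _ _) ?_ ?_
  · exact (inl_biprodConn X Y).symm
  · exact biprodConn_fst X Y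

lemma IsExact.right_mem_of_biprod_mem (hs : s.IsExact) {X Y : SigmaSeq S n}
    (h : X.biprod Y ∈ s.angles) : Y ∈ s.angles := by
  have h' : s.Realizes (toExt (biprodConn X Y)) ⟨X.seq.biprod Y.seq, Iso.refl _, Iso.refl _⟩ := h
  refine hs.realizes_of_retract h' (Y := ⟨Y.seq, Iso.refl _, Iso.refl _⟩)
    (Seq.biprodInr X.seq Y.seq) (Seq.biprodSnd X.seq Y.seq)
    (a := Seq.app (Seq.biprodInr X.seq Y.seq) 0) (c := Seq.app (Seq.biprodInr X.seq Y.seq) (n + 1))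
    (a' := Seq.app (Seq.biprodSnd X.seq Y.seq) 0)
    (c' := Seq.app (Seq.biprodSnd X.seq Y.seq) (n + 1))
    (isLift_app _) (isLift_app _) (Seq.biprodInr_snd _ _) ?_ ?_
  · exact (inr_biprodConn X Y).symm
  · exact biprodConn_snd X Y

/-- Lifts along the inclusions and projections, between an arbitrary realization `Z` of the summed
extension and `X`, `Y`, add up to lifts of the identities between `Z` and the direct sum. -/
lemma IsExact.biprod_mem (hs : s.IsExact) {X Y : SigmaSeq S n}
    (hX : X ∈ s.angles) (hY : Y ∈ s.angles) : X.biprod Y ∈ s.angles := by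
  have hX' : s.Realizes (toExt X.conn) ⟨X.seq, Iso.refl _, Iso.refl _⟩ := hX
  have hY' : s.Realizes (toExt Y.conn) ⟨Y.seq, Iso.refl _, Iso.refl _⟩ := hY
  obtain ⟨Z, hZ⟩ := s.exists_realizes (toExt (biprodConn X Y))
  obtain ⟨f₁, hf₁⟩ := hX'.exists_lift hZ (Seq.app (Seq.biprodInl X.seq Y.seq) 0)
    (Seq.app (Seq.biprodInl X.seq Y.seq) (n + 1)) (inl_biprodConn X Y).symm
  obtain ⟨f₂, hf₂⟩ := hY'.exists_lift hZ (Seq.app (Seq.biprodInr X.seq Y.seq) 0)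
    (Seq.app (Seq.biprodInr X.seq Y.seq) (n + 1)) (inr_biprodConn X Y).symm
  obtain ⟨g₁, hg₁⟩ := hZ.exists_lift hX' (Seq.app (Seq.biprodFst X.seq Y.seq) 0)
    (Seq.app (Seq.biprodFst X.seq Y.seq) (n + 1)) (biprodConn_fst X Y)
  obtain ⟨g₂, hg₂⟩ := hZ.exists_lift hY' (Seq.app (Seq.biprodSnd X.seq Y.seq) 0)
    (Seq.app (Seq.biprodSnd X.seq Y.seq) (n + 1)) (biprodConn_snd X Y)
  simp only [IsLift, Iso.refl_hom, Category.id_comp, Category.comp_id] at hf₁ hf₂ hg₁ hg₂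
  refine hs.realizes_of_lifts (Y := ⟨X.seq.biprod Y.seq, Iso.refl _, Iso.refl _⟩) hZ
    (hX'.1.biprod hY'.1) ((hs.rightExact hX').biprod (hs.rightExact hY'))
    ⟨Seq.homAdd (g₁ ≫ Seq.biprodInl X.seq Y.seq) (g₂ ≫ Seq.biprodInr X.seq Y.seq), ?_⟩
    ⟨Seq.homAdd (Seq.biprodFst X.seq Y.seq ≫ f₁) (Seq.biprodSnd X.seq Y.seq ≫ f₂), ?_⟩
  · simp only [IsLift, Seq.homAdd, Seq.app_homMk, Seq.app_comp, Iso.refl_hom, Category.comp_id,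
      hg₁, hg₂, Category.assoc, ← Preadditive.comp_add, Seq.biprod_total, and_self]
  · simp only [IsLift, Seq.homAdd, Seq.app_homMk, Seq.app_comp, Iso.refl_hom, Category.comp_id,
      hf₁, hf₂, Preadditive.add_comp, Category.assoc, Seq.biprod_total, and_self]

end Biprod

section Rotation

variable [HasBinaryBiproducts 𝒞] [S.IsEquivalence]

/-- Write `X.conn` as the pullback of `𝟙 (S X⁰)` along itself. The cone of a good lift to `X⁰ → 0 →
⋯ → S X⁰` has terms `X¹, …, Xⁿ⁺¹, S X⁰` and realizes `S d⁰`, but its differentials `dⁱ` carry a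
minus sign. -/
lemma IsExangulated.rotate_mem (hs : s.IsExangulated) {X : SigmaSeq S n} (hX : X ∈ s.angles) :
    ofSnoc (fun i => X.seq.obj (i + 1)) (fun i => X.seq.d (i + 1)) (Z := S.obj (X.seq.obj 0))
      X.conn ((-1 : ℤ) ^ n • S.map (X.seq.d 0)) ∈ s.angles := by
  have hX' : s.Realizes (pull X.conn (toExt (𝟙 (S.obj (X.seq.obj 0)))))
      ⟨X.seq, Iso.refl _, Iso.refl _⟩ := by
    rw [pull_toExt, Category.comp_id]
    exact hX
  obtain ⟨F, hF, hR⟩ := hs.exists_good_lift _ _ _ _ hX'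
    (hs.isExact.realizes_shiftEnd (X.seq.obj 0))
  have hF₂ := hF.2
  simp only [Iso.refl_hom, Category.id_comp] at hF₂
  have hd : (shift S n (X.seq.obj 0)).seq.d n = 0 :=
    (isZero_shift S n _ n (NeZero.ne n) le_rfl).eq_of_src _ _
  rw [push_toExt] at hR
  refine hs.isExact.ofSnoc_mem_angles_of_cone hR
    -- Alternating signs absorb the minus signs of the cone. The last differential `X.conn` has
    -- none, so the last sign repeats `(-1)ⁿ`, which is the sign of the rotated connecting morphism.
    (fun i => (-1 : ℤ) ^ i • Seq.coneFst X.seq (shift S n (X.seq.obj 0)).seq i)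
    ((-1 : ℤ) ^ n • 𝟙 _) (fun i hi => ?_) ?_ (fun i hi => ?_) (isIso_neg_one_pow_zsmul n _)
    (𝟙 _) (one_smul _ _) ?_
  · rw [Preadditive.comp_zsmul, Seq.coneD_fst, Preadditive.zsmul_comp, pow_succ, mul_neg_one,
      neg_smul_neg]
  · rw [Seq.coneLast_eq, hd, comp_zero, add_zero, Category.assoc, reassoc_of% hF₂,
      Preadditive.comp_zsmul, Category.comp_id, Preadditive.comp_zsmul, Preadditive.zsmul_comp]
  · have := Seq.isIso_coneFst (X := X.seq) (Y := (shift S n (X.seq.obj 0)).seq) i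
      fun h => isZero_shift S n _ i h hi
    exact isIso_neg_one_pow_zsmul i _
  · simp [smul_smul, ← mul_pow]

/-- The rotated connecting morphism is the pushforward of `𝟙 (S X⁰)` along `(-1)ⁿ d⁰`. The cocone of
a good lift from `X⁰ → 0 → ⋯ → S X⁰` restores `X⁰` and realizes `X.conn`. -/
lemma IsExangulated.mem_of_rotate_mem (hs : s.IsExangulated) {X : SigmaSeq S n}
    (hX : ofSnoc (fun i => X.seq.obj (i + 1)) (fun i => X.seq.d (i + 1))
      (Z := S.obj (X.seq.obj 0)) X.conn ((-1 : ℤ) ^ n • S.map (X.seq.d 0)) ∈ s.angles) :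
    X ∈ s.angles := by
  have := hs.isBiadditive.additive
  let l := ofSnocIso (S := S) (n := n) (fun i => X.seq.obj (i + 1)) (fun i => X.seq.d (i + 1))
    (Z := S.obj (X.seq.obj 0)) X.conn ((-1 : ℤ) ^ n • S.map (X.seq.d 0))
  have hX' := hs.isExact.realizes_of_mem hX (l 0 (Nat.zero_le n)) (ofSnocLastIso _ _ _ _)
    (δ := 𝟙 _ ≫ S.map ((-1 : ℤ) ^ n • X.seq.d 0)) (by
      rw [ofSnoc_conn, Category.assoc, Category.assoc, ← S.map_comp, Iso.inv_hom_id, S.map_id,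
        Category.comp_id, Category.id_comp, S.map_zsmul])
  obtain ⟨F, hF, hR⟩ := hs.exists_good_lift_op _ _ _ _
    (hs.isExact.realizes_shiftEnd (X.seq.obj 0)) hX'
  have hF₁ := hF.1
  dsimp only at F hF₁ hR
  have hz (i : ℕ) (hi : i < n) : IsZero ((shift S n (X.seq.obj 0)).seq.obj (i + 1)) :=
    isZero_shift S n _ _ (by omega) hi
  rw [pull_toExt, Category.comp_id] at hR
  -- The cocone has first differential `(-1)ⁿ d⁰` and all others negated. The signs `(-1)ⁿ⁺ⁱ` in
  -- degree `i + 1 ≤ n` correct this with sign `1` in degrees `0` and `n + 1`, so the connecting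
  -- morphism is unaffected.
  refine hs.isExact.mem_angles_of_cocone hR (fun i hi => match i, hi with
      | 0, _ => (Seq.coconeZero _ _).hom ≫ (shiftLeft S n _).hom
      | i + 1, hi => (-1 : ℤ) ^ (n + i) • Seq.coconeSnd _ _ i ≫ (l i (by omega)).hom)
    (l n le_rfl).hom (fun i hi => ?_) ?_ (fun i hi => ?_) inferInstance (𝟙 _) ?_ ?_
  · cases i with
    | zero =>
      dsimp only
      rw [Preadditive.comp_zsmul, reassoc_of% Seq.coconeD_zero_snd, hF₁, add_zero]
      simp [smul_smul, ← mul_pow]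
    | succ i =>
      dsimp only
      rw [Preadditive.comp_zsmul, ← Category.assoc, Seq.coconeD_succ_snd F i (hz i (by omega)),
        ofSnoc_d _ _ _ _ i (by omega), Preadditive.neg_comp, Category.assoc, Category.assoc,
        Category.assoc, Iso.inv_hom_id, Category.comp_id, ← add_assoc, pow_succ, mul_neg_one,
        neg_smul_neg, Preadditive.zsmul_comp, Category.assoc]
  · obtain ⟨m, rfl⟩ := Nat.exists_eq_succ_of_ne_zero (NeZero.ne n)
    dsimp only
    rw [Seq.coconeLast_succ F m (hz m (by omega)), ofSnoc_d _ _ _ _ m (by omega),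
      Preadditive.neg_comp, Category.assoc, Category.assoc, Category.assoc, Iso.inv_hom_id,
      Category.comp_id, Preadditive.zsmul_comp, Category.assoc]
    have h : (-1 : ℤ) ^ (m.succ + m) = -1 := Odd.neg_one_pow ⟨m, by omega⟩
    rw [h, neg_one_zsmul]
  · cases i with
    | zero => dsimp only; infer_instance
    | succ i =>
      have h := Seq.isIso_coconeSnd (Y := (ofSnoc (S := S) (n := n) (fun i => X.seq.obj (i + 1))
        (fun i => X.seq.d (i + 1)) (Z := S.obj (X.seq.obj 0)) X.conn
          ((-1 : ℤ) ^ n • S.map (X.seq.d 0))).seq) i (hz i (by omega))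
      exact isIso_neg_one_pow_zsmul _ _
  · dsimp only
    rw [Category.comp_id]
    exact Category.id_comp (shiftLeft S n _).hom
  · rw [ofSnoc_d_last]
    simp [l]

/-- Realize `S f`, the pushforward of `𝟙 (S A)` along `f`. The cocone of a good lift from `A → 0 → ⋯
→ S A` starts with the degree `0` component of the lift, which is `f`. -/
lemma IsExangulated.exists_first (hs : s.IsExangulated) {A B : 𝒞} (f : A ⟶ B) :
    ∃ X ∈ s.angles, Nonempty (Arrow.mk (X.seq.d 0) ≅ Arrow.mk f) := by
  obtain ⟨Y, hY⟩ := s.exists_realizes (push f (toExt (𝟙 (S.obj A))))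
  obtain ⟨F, hF, hR⟩ := hs.exists_good_lift_op _ _ _ _ (hs.isExact.realizes_shiftEnd A) hY
  rw [pull_toExt] at hR
  let G : EndSeq n A (Y.seq.obj n) := EndSeq.cocone F
  refine ⟨⟨G.seq, G.right.hom ≫ ((Y.seq.d n ≫ Y.right.hom) ≫ 𝟙 _) ≫ S.map G.left.inv⟩,
    hs.isExact.mem_angles hR (𝟙 G.seq) (fun i => IsIso.id (G.seq.obj i)) ?_, ⟨?_⟩⟩
  · rw [Seq.app_id, Seq.app_id, Category.comp_id, Category.comp_id, Category.id_comp]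
  · have h₁ : 1 ≤ n := Nat.one_le_iff_ne_zero.2 (NeZero.ne n)
    have hz := Seq.isIso_coconeSnd (Y := Y.seq) 0 (isZero_shift S n A 1 one_ne_zero h₁)
    let l : ∀ i (hi : i ≤ n), G.seq.obj i ≅ Seq.coconeObj (shift S n A).seq Y.seq i :=
      Seq.snocIso _ _ n _
    let r : G.seq.obj 1 ≅ B :=
      l 1 h₁ ≪≫ asIso (Seq.coconeSnd (shift S n A).seq Y.seq 0) ≪≫ Y.left
    have e₁ : G.left.hom = (l 0 (Nat.zero_le n)).hom ≫ (Seq.coconeZero _ _).hom ≫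
        (shiftLeft S n A).hom := congrArg (_ ≫ ·) (Category.id_comp _).symm
    have e₂ : G.seq.d 0 = (l 0 (Nat.zero_le n)).hom ≫ Seq.coconeD F 0 ≫ (l 1 h₁).inv :=
      Seq.snoc_d' 0 h₁
    have e₃ := hF.1
    dsimp only at e₃
    refine Arrow.isoMk G.left r (?_ : G.left.hom ≫ f = G.seq.d 0 ≫ r.hom)
    simp only [e₁, e₂, r, Iso.trans_hom, asIso_hom, Category.assoc, Iso.inv_hom_id_assoc]
    rw [reassoc_of% Seq.coconeD_zero_snd, e₃]

/-- After left rotation the commutative square says that `(b, S a)` is a morphism of extensions, so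
it lifts; shifting the degrees of the lift by one and putting `a` in degree `0` gives the morphism.
-/
lemma IsExangulated.exists_hom (hs : s.IsExangulated) {X Y : SigmaSeq S n} (hX : X ∈ s.angles)
    (hY : Y ∈ s.angles) (a : X.seq.obj 0 ⟶ Y.seq.obj 0) (b : X.seq.obj 1 ⟶ Y.seq.obj 1)
    (hab : X.seq.d 0 ≫ b = a ≫ Y.seq.d 0) :
    ∃ f : X ⟶ Y, Seq.app (toSeqHom f) 0 = a ∧ Seq.app (toSeqHom f) 1 = b := by
  let l (X : SigmaSeq S n) := ofSnocIso (S := S) (n := n) (fun i => X.seq.obj (i + 1))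
    (fun i => X.seq.d (i + 1)) (Z := S.obj (X.seq.obj 0)) X.conn ((-1 : ℤ) ^ n • S.map (X.seq.d 0))
  let r (X : SigmaSeq S n) := ofSnocLastIso (S := S) (n := n) (fun i => X.seq.obj (i + 1))
    (fun i => X.seq.d (i + 1)) (Z := S.obj (X.seq.obj 0)) X.conn ((-1 : ℤ) ^ n • S.map (X.seq.d 0))
  have h {X : SigmaSeq S n} (hX : X ∈ s.angles) :=
    hs.isExact.realizes_of_mem (hs.rotate_mem hX) (l X 0 (Nat.zero_le n)) (r X)
      (δ := (-1 : ℤ) ^ n • S.map (X.seq.d 0)) (by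
        rw [ofSnoc_conn, Category.assoc, Category.assoc, ← S.map_comp, Iso.inv_hom_id, S.map_id,
          Category.comp_id])
  obtain ⟨F, hF₁, hF₂⟩ := (h hX).exists_lift (h hY) b (S.map a) (by
    rw [push_toExt, pull_toExt, Preadditive.zsmul_comp, Preadditive.comp_zsmul, ← S.map_comp, hab,
      S.map_comp])
  dsimp only at F hF₁ hF₂
  let g (i : ℕ) : X.seq.obj (i + 1) ⟶ Y.seq.obj (i + 1) :=
    if h : i ≤ n then (l X i h).inv ≫ Seq.app F i ≫ (l Y i h).hom else 0
  have hg (i : ℕ) (hi : i ≤ n) : g i = (l X i hi).inv ≫ Seq.app F i ≫ (l Y i hi).hom := dif_pos hi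
  have hb : g 0 = b := by rw [hg 0 (Nat.zero_le n), hF₁, Iso.inv_hom_id_assoc]
  refine ⟨⟨Seq.homMk (fun i => match i with
    | 0 => a
    | i + 1 => g i) fun i => ?_, ?_⟩, rfl, hb⟩
  · cases i with
    | zero => exact (congrArg (_ ≫ ·) hb).trans hab
    | succ i =>
      by_cases hi : i < n
      · have hc := Seq.app_comm F i
        rw [ofSnoc_d _ _ _ _ i hi, ofSnoc_d _ _ _ _ i hi] at hc
        dsimp only
        rw [hg (i + 1) hi, hg i hi.le, ← cancel_epi (l X i hi.le).hom,
          ← cancel_mono (l Y (i + 1) hi).inv]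
        simpa [l] using hc
      · exact (Y.seq.isZero (i + 2) (by omega)).eq_of_tgt _ _
  · have hc := Seq.app_comm F n
    rw [ofSnoc_d_last, ofSnoc_d_last] at hc
    change X.conn ≫ S.map a = g n ≫ Y.conn
    rw [hg n le_rfl, ← cancel_epi (l X n le_rfl).hom, ← cancel_mono (r Y).inv]
    have hc' := hF₂
    rw [← Iso.eq_comp_inv] at hc'
    rw [hc'] at hc
    simpa [l, r] using hc

end Rotation

end Realization

/-! ### The mapping cone of a morphism `X ⊕ (A = A) ⟶ W ⊕ Y` -/

namespace Seq

section Biprod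

variable {𝒞 : Type u} [Category.{v} 𝒞] [Preadditive 𝒞] [HasBinaryBiproducts 𝒞] {m : ℕ}
  {X Y : Seq 𝒞 m}

/-- The terms of a direct sum of sequences. -/
noncomputable def biprodObjIso (i : ℕ) {A B : 𝒞} (e : X.obj i ≅ A) (e' : Y.obj i ≅ B) :
    (X.biprod Y).obj i ≅ A ⊞ B :=
  biprod.mapIso e e'

variable (i : ℕ) {A B : 𝒞} (e : X.obj i ≅ A) (e' : Y.obj i ≅ B)

lemma inl_biprodObjIso : app (biprodInl X Y) i ≫ (biprodObjIso i e e').hom = e.hom ≫ biprod.inl :=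
  biprod.inl_map e.hom e'.hom

lemma inr_biprodObjIso : app (biprodInr X Y) i ≫ (biprodObjIso i e e').hom = e'.hom ≫ biprod.inr :=
  biprod.inr_map e.hom e'.hom

lemma biprodObjIso_fst : (biprodObjIso i e e').hom ≫ biprod.fst = app (biprodFst X Y) i ≫ e.hom :=
  biprod.map_fst e.hom e'.hom

lemma biprodObjIso_snd : (biprodObjIso i e e').hom ≫ biprod.snd = app (biprodSnd X Y) i ≫ e'.hom :=
  biprod.map_snd e.hom e'.hom

/-- The terms of a direct sum of sequences in degrees where the second summand vanishes. -/
noncomputable def biprodObjIsoLeft (h : IsZero (Y.obj i)) : (X.biprod Y).obj i ≅ X.obj i where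
  hom := app (biprodFst X Y) i
  inv := app (biprodInl X Y) i
  hom_inv_id := by
    rw [← biprod_total X Y i, h.eq_of_src (app (biprodInr X Y) i) 0, comp_zero, add_zero]
  inv_hom_id := app_biprodInl_fst X Y i

lemma isIso_app_biprodFst (h : IsZero (Y.obj i)) : IsIso (app (biprodFst X Y) i) :=
  isIso_biprod_fst h

lemma isIso_app_biprodSnd (h : IsZero (X.obj i)) : IsIso (app (biprodSnd X Y) i) :=
  isIso_biprod_snd h

end Biprod

section Triv

variable {𝒞 : Type u} [Category.{v} 𝒞] [Preadditive 𝒞] [HasZeroObject 𝒞] (A : 𝒞) (n : ℕ)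

/-- The term of degree `0` of `Seq.trivLeft`. -/
noncomputable def trivZero : (trivLeft A n).obj 0 ≅ A := Iso.refl _

/-- The term of degree `1` of `Seq.trivLeft`. -/
noncomputable def trivOne : (trivLeft A n).obj 1 ≅ A := Iso.refl _

lemma trivLeft_d : (trivLeft A n).d 0 = (trivZero A n).hom ≫ (trivOne A n).inv :=
  (Category.id_comp (𝟙 A)).symm

lemma isZero_trivLeft (i : ℕ) : IsZero ((trivLeft A n).obj (i + 2)) := isZero_zero 𝒞

end Triv

section Cone

variable {𝒞 : Type u} [Category.{v} 𝒞] [Preadditive 𝒞] [HasZeroObject 𝒞] [HasBinaryBiproducts 𝒞]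
  {n : ℕ} {X Y W : Seq 𝒞 (n + 1)} {A : 𝒞} (F : X.biprod (trivLeft A n) ⟶ W.biprod Y)

/-- The component `X ⟶ Y` of a morphism between direct sums. -/
noncomputable def corner : X ⟶ Y := biprodInl _ _ ≫ F ≫ biprodSnd _ _

lemma app_corner (i : ℕ) :
    app (corner F) i = app (biprodInl X (trivLeft A n)) i ≫ app F i ≫ app (biprodSnd W Y) i := rfl

/-- The projection of the mapping cone of `F` to the terms of `X`. -/
noncomputable def coneLeft (X Y W : Seq 𝒞 (n + 1)) (A : 𝒞) (i : ℕ) :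
    coneObj (X.biprod (trivLeft A n)) (W.biprod Y) i ⟶ X.obj (i + 1) :=
  coneFst _ _ i ≫ app (biprodFst X (trivLeft A n)) (i + 1)

/-- The projection of the mapping cone of `F` to the terms of `Y`. -/
noncomputable def coneRight (X Y W : Seq 𝒞 (n + 1)) :
    ∀ i, coneObj (X.biprod (trivLeft (Y.obj 0) n)) (W.biprod Y) i ⟶ Y.obj i
  | 0 => coneFst _ _ 0 ≫ app (biprodSnd X (trivLeft (Y.obj 0) n)) 1 ≫ (trivOne _ n).hom
  | i + 1 => coneSnd _ _ (i + 1) ≫ app (biprodSnd W Y) (i + 1)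

lemma coneD_left (i : ℕ) : coneD F i ≫ coneLeft X Y W A (i + 1) =
    -coneLeft X Y W A i ≫ X.d (i + 1) := by
  rw [coneLeft, ← Category.assoc, coneD_fst, coneLeft, Category.assoc, Preadditive.neg_comp,
    Category.assoc, app_comm]

/-- The `Y`-part of the cone differential of `F` agrees with that of the cone of its corner. The
copy of `Y⁰` in degree `1` of the trivial summand plays the role of the term `Y⁰`, and `hF` says
that `F` acts on it by `d⁰`; in higher degrees the trivial summand is zero. -/
lemma cone_component_right (F : X.biprod (trivLeft (Y.obj 0) n) ⟶ W.biprod Y)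
    (hF : (trivOne (Y.obj 0) n).inv ≫ app (biprodInr X (trivLeft (Y.obj 0) n)) 1 ≫ app F 1 ≫
      app (biprodSnd W Y) 1 = Y.d 0) (i : ℕ) :
    (coneFst _ _ i ≫ app F (i + 1) + coneSnd _ _ i ≫ (W.biprod Y).d i) ≫
      app (biprodSnd W Y) (i + 1) =
    coneLeft X Y W (Y.obj 0) i ≫ app (corner F) (i + 1) + coneRight X Y W i ≫ Y.d i := by
  cases i with
  | zero =>
    have h : app F 1 ≫ app (biprodSnd W Y) 1 =
        app (biprodFst X (trivLeft (Y.obj 0) n)) 1 ≫ app (corner F) 1 +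
          app (biprodSnd X (trivLeft (Y.obj 0) n)) 1 ≫ (trivOne (Y.obj 0) n).hom ≫ Y.d 0 := by
      rw [← hF, Iso.hom_inv_id_assoc, app_corner, ← Category.assoc,
        ← Category.assoc (app (biprodSnd X _) 1), ← Preadditive.add_comp, biprod_total,
        Category.id_comp]
    have h₀ : coneSnd (X.biprod (trivLeft (Y.obj 0) n)) (W.biprod Y) 0 = 0 := rfl
    rw [h₀, zero_comp, add_zero, Category.assoc, h, coneLeft, coneRight, Preadditive.comp_add]
    simp only [Category.assoc]
  | succ i =>
    have h : app F (i + 2) ≫ app (biprodSnd W Y) (i + 2) =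
        app (biprodFst X (trivLeft (Y.obj 0) n)) (i + 2) ≫ app (corner F) (i + 2) := by
      refine biprod_hom_ext' ?_ ((isZero_trivLeft (Y.obj 0) n i).eq_of_src _ _)
      rw [← Category.assoc _ _ (app (corner F) (i + 2)), app_biprodInl_fst, Category.id_comp,
        app_corner]
    rw [Preadditive.add_comp, Category.assoc, h, Category.assoc, app_comm, coneLeft, coneRight,
      Category.assoc, Category.assoc]

lemma lift_cone_zero : biprod.lift (coneLeft X Y W (Y.obj 0) 0) (coneRight X Y W 0) =
    coneFst _ _ 0 ≫ (biprodObjIso 1 (Iso.refl _) (trivOne (Y.obj 0) n)).hom := by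
  apply biprod.hom_ext
  · rw [biprod.lift_fst, Category.assoc, biprodObjIso_fst, coneLeft, Iso.refl_hom,
      Category.comp_id]
  · rw [biprod.lift_snd, Category.assoc, biprodObjIso_snd, coneRight]

/-- The shear by `φ` is unipotent, so one may take `φ = 0`; then only zero summands are dropped. The
shear is what makes the cones of homotopic morphisms isomorphic. -/
lemma isIso_lift_cone (i : ℕ) (h : i ≠ 0 → IsZero (W.obj i)) (φ : X.obj (i + 1) ⟶ Y.obj i) :
    IsIso (biprod.lift (coneLeft X Y W (Y.obj 0) i)
      (coneRight X Y W i - coneLeft X Y W (Y.obj 0) i ≫ φ)) := by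
  suffices IsIso (biprod.lift (coneLeft X Y W (Y.obj 0) i) (coneRight X Y W i)) by
    have e : biprod.lift (coneLeft X Y W (Y.obj 0) i)
        (coneRight X Y W i - coneLeft X Y W (Y.obj 0) i ≫ φ) =
        biprod.lift (coneLeft X Y W (Y.obj 0) i) (coneRight X Y W i) ≫
          (Biprod.unipotentUpper (-φ)).hom := by
      apply biprod.hom_ext <;> simp [sub_eq_neg_add, add_comm]
    rw [e]
    infer_instance
  cases i with
  | zero =>
    have := isIso_coneFst (X := X.biprod (trivLeft (Y.obj 0) n)) (Y := W.biprod Y) 0 (by simp)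
    rw [lift_cone_zero]
    infer_instance
  | succ i =>
    have h' {A B C D : 𝒞} (p : A ⟶ C) (q : B ⟶ D) (hp : IsIso p) (hq : IsIso q) :
        IsIso (biprod.lift (biprod.fst ≫ p) (biprod.snd ≫ q)) := by
      have e : biprod.lift (biprod.fst ≫ p) (biprod.snd ≫ q) = biprod.map p q := by
        apply biprod.hom_ext <;> simp
      exact e ▸ isIso_biprod_map p q
    exact h' (app (biprodFst X (trivLeft (Y.obj 0) n)) (i + 2)) (app (biprodSnd W Y) (i + 1))
      (isIso_app_biprodFst _ (isZero_trivLeft _ n i)) (isIso_app_biprodSnd _ (h (by omega)))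

end Cone

end Seq

/-! ### The cone axiom -/

namespace Realization

open SigmaSeq

variable {𝒞 : Type u} [Category.{v} 𝒞] [Preadditive 𝒞] [HasZeroObject 𝒞] {S : 𝒞 ⥤ 𝒞} {n : ℕ}
  [NeZero n] {s : Realization (homShift S) n}

lemma IsExact.d_conn (hs : s.IsExact) {X : SigmaSeq S n} (hX : X ∈ s.angles) :
    X.seq.d n ≫ X.conn = 0 := by
  have h := (hs.isExangle _ _ hX).exact_left_last (X.seq.obj n)
  have h' := (h (X.seq.d n)).2 ⟨𝟙 _, Category.id_comp _⟩
  change X.seq.d n ≫ 𝟙 _ ≫ X.conn ≫ S.map (𝟙 _) = 0 at h'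
  simpa using h'

variable [HasBinaryBiproducts 𝒞] [S.IsEquivalence]

lemma IsExact.realizes_biprod (hs : s.IsExact) {X Y : SigmaSeq S n} (hX : X ∈ s.angles)
    (hY : Y ∈ s.angles) {A C : 𝒞} (l : (X.seq.biprod Y.seq).obj 0 ≅ A)
    (r : (X.seq.biprod Y.seq).obj (n + 1) ≅ C) {δ : C ⟶ S.obj A}
    (h₁ : X.conn ≫ S.map (Seq.app (Seq.biprodInl X.seq Y.seq) 0 ≫ l.hom) =
      Seq.app (Seq.biprodInl X.seq Y.seq) (n + 1) ≫ r.hom ≫ δ)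
    (h₂ : Y.conn ≫ S.map (Seq.app (Seq.biprodInr X.seq Y.seq) 0 ≫ l.hom) =
      Seq.app (Seq.biprodInr X.seq Y.seq) (n + 1) ≫ r.hom ≫ δ) :
    s.Realizes (toExt δ) ⟨X.seq.biprod Y.seq, l, r⟩ := by
  refine hs.realizes_of_mem (hs.biprod_mem hX hY) l r ?_
  change biprodConn X Y ≫ S.map l.hom = r.hom ≫ δ
  refine Seq.biprod_hom_ext' ?_ ?_
  · rw [← h₁, ← Category.assoc, inl_biprodConn, Category.assoc, S.map_comp]
  · rw [← h₂, ← Category.assoc, inr_biprodConn, Category.assoc, S.map_comp]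

lemma IsExangulated.exists_hom_cone_mem (hs : s.IsExangulated) {X Y : SigmaSeq S n}
    (hX : X ∈ s.angles) (hY : Y ∈ s.angles) (a : X.seq.obj 0 ⟶ Y.seq.obj 0)
    (b : X.seq.obj 1 ⟶ Y.seq.obj 1) (hab : X.seq.d 0 ≫ b = a ≫ Y.seq.d 0) :
    ∃ f : X ⟶ Y, Seq.app (toSeqHom f) 0 = a ∧ Seq.app (toSeqHom f) 1 = b ∧
      SigmaSeq.cone f ∈ s.angles := by
  have := hs.isBiadditive.additive
  -- Only this last component of an arbitrary extension of the square is kept; the final morphism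
  -- comes from the good lift below.
  obtain ⟨c, hc⟩ : ∃ c, X.conn ≫ S.map a = c ≫ Y.conn := by
    obtain ⟨g, rfl, -⟩ := hs.exists_hom hX hY a b hab
    exact ⟨_, g.comm⟩
  -- This needs `n ≥ 1`: the trivial sequence is nonzero in degree `1`.
  have hn : (Seq.trivLeft (Y.seq.obj 0) n).obj (n + 1) = 0 := by
    obtain ⟨m, rfl⟩ := Nat.exists_eq_succ_of_ne_zero (NeZero.ne n)
    rfl
  have hz : IsZero ((Seq.trivLeft (Y.seq.obj 0) n).obj (n + 1)) := hn ▸ isZero_zero 𝒞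
  have hW (i : ℕ) (h : i ≠ 0) (hi : i ≤ n) := isZero_shift S n (X.seq.obj 0) i h hi
  -- the two exangles with common initial term
  let ρ : S.obj (X.seq.obj 0) ⊞ Y.seq.obj (n + 1) ⟶ S.obj (X.seq.obj 0 ⊞ Y.seq.obj 0) :=
    biprod.desc (S.map biprod.inl) (Y.conn ≫ S.map biprod.inr)
  -- The twist `(x, y) ↦ (x, y + a x)` turns the extension `(X.conn, 0)` into `(X.conn, S a ∘
  -- X.conn) = (X.conn, Y.conn ∘ c)`, the pullback of `ρ` along `(X.conn, c)`. It also makes `a` the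
  -- degree `0` component of the corner.
  let pl : (X.seq.biprod (Seq.trivLeft (Y.seq.obj 0) n)).obj 0 ≅ X.seq.obj 0 ⊞ Y.seq.obj 0 :=
    Seq.biprodObjIso 0 (Iso.refl _) (Seq.trivZero _ n) ≪≫ Biprod.unipotentUpper a
  let pr := Seq.biprodObjIsoLeft (X := X.seq) (n + 1) hz
  let ql := Seq.biprodObjIso (Y := Y.seq) 0 (shiftLeft S n (X.seq.obj 0)) (Iso.refl _)
  let qr := Seq.biprodObjIso (Y := Y.seq) (n + 1) (shiftRight S n (X.seq.obj 0)) (Iso.refl _)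
  have hP : s.Realizes (pull (biprod.lift X.conn c) (toExt ρ))
      ⟨X.seq.biprod (Seq.trivLeft (Y.seq.obj 0) n), pl, pr⟩ := by
    refine hs.isExact.realizes_biprod hX (hs.isExact.triv_mem (Y.seq.obj 0)) pl pr ?_
      (hz.eq_of_src _ _)
    have h : Seq.app (Seq.biprodInl X.seq (Seq.trivLeft (Y.seq.obj 0) n)) 0 ≫ pl.hom =
        biprod.inl + a ≫ biprod.inr := by
      rw [Iso.trans_hom, ← Category.assoc, Seq.inl_biprodObjIso]
      apply biprod.hom_ext <;> simp
    have h' : Seq.app (Seq.biprodInl X.seq (Seq.trivLeft (Y.seq.obj 0) n)) (n + 1) ≫ pr.hom =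
        𝟙 _ := pr.inv_hom_id
    refine (congr(X.conn ≫ S.map $h)).trans (.trans ?_ (Category.assoc _ _ _))
    refine .trans ?_ congr($h' ≫ biprod.lift X.conn c ≫ ρ).symm
    rw [Category.id_comp, biprod.lift_desc, S.map_add, S.map_comp, Preadditive.comp_add,
      reassoc_of% hc]
  have hQ : s.Realizes (toExt ρ) ⟨(shift S n (X.seq.obj 0)).seq.biprod Y.seq, ql, qr⟩ := by
    refine hs.isExact.realizes_biprod (hs.isExact.shift_mem _) hY ql qr ?_ ?_
    · rw [Seq.inl_biprodObjIso, ← Category.assoc, Seq.inl_biprodObjIso, Category.assoc,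
        biprod.inl_desc, shift_conn, S.map_comp, Category.assoc, ← S.map_comp_assoc,
        Iso.inv_hom_id, S.map_id, Category.id_comp]
    · rw [Seq.inr_biprodObjIso, ← Category.assoc, Seq.inr_biprodObjIso, Category.assoc,
        biprod.inr_desc, Iso.refl_hom, Category.id_comp, Iso.refl_hom, Category.id_comp]
  obtain ⟨F, ⟨hF₁, hF₂⟩, hR⟩ := hs.exists_good_lift _ _ _ _ hP hQ
  dsimp only at F hF₁ hF₂ hR
  rw [push_toExt] at hR
  have hF₃ : Seq.app F 0 ≫ Seq.app (Seq.biprodSnd _ _) 0 = pl.hom ≫ biprod.snd := by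
    rw [← Category.comp_id pl.hom, ← hF₁, Category.assoc, Seq.biprodObjIso_snd, Iso.refl_hom,
      Category.comp_id]
  have hF₄ : Seq.app F (n + 1) ≫ Seq.app (Seq.biprodSnd _ _) (n + 1) =
      Seq.app (Seq.biprodFst _ _) (n + 1) ≫ c := by
    have h := congr($hF₂ ≫ biprod.snd)
    rw [Category.assoc, Seq.biprodObjIso_snd, Iso.refl_hom, Category.comp_id, Category.assoc,
      biprod.lift_snd] at h
    exact h
  have hF₅ : Seq.app F (n + 1) ≫ Seq.app (Seq.biprodFst _ _) (n + 1) ≫ (shiftRight S n _).hom =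
      Seq.app (Seq.biprodFst _ _) (n + 1) ≫ X.conn := by
    have h := congr($hF₂ ≫ biprod.fst)
    rw [Category.assoc, Seq.biprodObjIso_fst, Category.assoc, biprod.lift_fst] at h
    exact h
  -- On the trivial summand the first differential is an identity, so the degree `1` component of
  -- `F` is determined by the degree `0` one, which induces the identity of `Y⁰`.
  have hF₆ : (Seq.trivOne (Y.seq.obj 0) n).inv ≫
      Seq.app (Seq.biprodInr X.seq (Seq.trivLeft (Y.seq.obj 0) n)) 1 ≫ Seq.app F 1 ≫
      Seq.app (Seq.biprodSnd _ _) 1 = Y.seq.d 0 := by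
    have h := Seq.app_comm (Seq.biprodInr X.seq (Seq.trivLeft (Y.seq.obj 0) n)) 0
    rw [Seq.trivLeft_d, Category.assoc] at h
    rw [← cancel_epi (Seq.trivZero (Y.seq.obj 0) n).hom, ← Category.assoc, ← Category.assoc,
      ← Category.assoc, Category.assoc _ _ (Seq.app (Seq.biprodInr _ _) 1), h, Category.assoc,
      Category.assoc, ← Category.assoc _ (Seq.app F 1), Seq.app_comm, Category.assoc,
      Seq.app_comm, ← Category.assoc (Seq.app F 0), hF₃, ← Category.assoc, ← Category.assoc,
      Iso.trans_hom, ← Category.assoc, Seq.inr_biprodObjIso]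
    simp
  have h₀ : Seq.app (Seq.corner F) 0 = a := by
    rw [Seq.app_corner, hF₃, Iso.trans_hom, Category.assoc, ← Category.assoc,
      Seq.inl_biprodObjIso]
    simp
  have h₁ : Seq.app (Seq.corner F) (n + 1) = c := by
    rw [Seq.app_corner, hF₄, ← Category.assoc, Seq.app_biprodInl_fst, Category.id_comp]
  -- adjusting the component of degree `1` by a homotopy
  obtain ⟨t, ht⟩ := hs.isExact.rightExact hX 0 (Nat.pos_of_ne_zero (NeZero.ne n))
    (b - Seq.app (Seq.corner F) 1) (by
      rw [Preadditive.comp_sub, hab, Seq.app_comm, h₀, sub_self])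
  -- With `φ 0 = 0`, the degree `0` component `a` and the initial term of the cone stay fixed.
  let φ : ∀ i, X.seq.obj (i + 1) ⟶ Y.seq.obj i
    | 0 => 0
    | 1 => t
    | _ + 2 => 0
  let g (i : ℕ) : X.seq.obj (i + 1) ⟶ Y.seq.obj (i + 1) :=
    Seq.app (Seq.corner F) (i + 1) + X.seq.d (i + 1) ≫ φ (i + 1) + φ i ≫ Y.seq.d i
  have hb : g 0 = b := by
    change Seq.app (Seq.corner F) 1 + X.seq.d 1 ≫ t + 0 ≫ Y.seq.d 0 = b
    rw [ht, zero_comp, add_zero, add_sub_cancel]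
  have hg (i : ℕ) : X.seq.d (i + 1) ≫ g (i + 1) = g i ≫ Y.seq.d (i + 1) := by
    simp only [g, Preadditive.comp_add, Preadditive.add_comp, Seq.app_comm, Category.assoc]
    rw [← Category.assoc (X.seq.d (i + 1)) (X.seq.d (i + 2)), hX.1 (i + 1), hY.1 i, zero_comp,
      comp_zero, add_zero, add_zero]
  -- For `n = 1` the homotopy also changes the last component, but by a morphism through `Y.seq.d
  -- n`, which `Y.conn` kills.
  have hg' : g n ≫ Y.conn = X.conn ≫ S.map a := by
    have h : X.seq.d (n + 1) = 0 := (X.seq.isZero (n + 2) (by omega)).eq_of_tgt _ _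
    simp only [g, h, h₁, zero_comp, add_zero, Preadditive.add_comp, Category.assoc,
      hs.isExact.d_conn hY, comp_zero, hc]
  have key : ofSnoc (fun i => X.seq.obj (i + 1) ⊞ Y.seq.obj i)
      (fun i => Biprod.ofComponents (-X.seq.d (i + 1)) (g i) 0 (Y.seq.d i))
      (Z := S.obj (X.seq.obj 0) ⊞ Y.seq.obj (n + 1))
      (Biprod.ofComponents (-X.conn) (g n) 0 (Y.seq.d n))
      (biprod.desc (-S.map (X.seq.d 0) ≫ S.map biprod.inl + S.map a ≫ S.map biprod.inr)
        (Y.conn ≫ S.map biprod.inr)) ∈ s.angles := by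
    have hi : IsIso (-𝟙 (S.obj (X.seq.obj 0))) := ⟨-𝟙 _, by simp, by simp⟩
    refine hs.isExact.ofSnoc_mem_angles_of_cone hR
      (fun i => biprod.lift (Seq.coneLeft _ _ _ _ i)
        (Seq.coneRight _ _ _ i - Seq.coneLeft _ _ _ _ i ≫ φ i))
      -- The sign on `S X⁰` accounts both for `-X.conn` and for the signs in the connecting morphism
      -- of the cone.
      (biprod.map (-𝟙 _) (𝟙 _)) (fun i hi => ?_) ?_
      (fun i hi => Seq.isIso_lift_cone i (fun h => hW i h hi) (φ i))
      (isIso_biprod_map (-𝟙 _) (𝟙 _))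
      (Seq.biprodObjIso 1 (Iso.refl _) (Seq.trivOne _ n)).hom ?_ ?_
    · apply biprod.hom_ext
      · rw [Category.assoc, biprod.lift_fst, Seq.coneD_left]
        simp
      · have h := Seq.coneD_snd F i
        have h' := Seq.cone_component_right F hF₆ i
        rw [← h, Category.assoc] at h'
        rw [Category.assoc, biprod.lift_snd, Preadditive.comp_sub, ← Category.assoc (Seq.coneD F i),
          Seq.coneD_left]
        refine (congrArg (· - _) h').trans ?_
        simp only [g, Biprod.ofComponents_snd, biprod.lift_fst_assoc, biprod.lift_snd_assoc,
          Preadditive.comp_add, Preadditive.sub_comp, Preadditive.neg_comp, Category.assoc]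
        abel
    · have hd : ((shift S n (X.seq.obj 0)).seq.biprod Y.seq).d n ≫
          Seq.app (Seq.biprodFst _ _) (n + 1) = 0 := by
        rw [Seq.app_comm, (hW n (NeZero.ne n) le_rfl).eq_of_src
          ((shift S n (X.seq.obj 0)).seq.d n) 0, comp_zero]
      apply biprod.hom_ext
      · have h : Seq.coneLast F n ≫ Seq.app (Seq.biprodFst _ _) (n + 1) ≫ (shiftRight S n _).hom =
            Seq.coneLeft _ _ _ _ n ≫ X.conn := by
          rw [Seq.coneLast_eq, Preadditive.add_comp, Category.assoc, hF₅, Category.assoc,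
            reassoc_of% hd, zero_comp, comp_zero, add_zero, Seq.coneLeft, Category.assoc]
        rw [Category.assoc, Category.assoc, biprod.map_fst, ← Category.assoc qr.hom,
          Seq.biprodObjIso_fst, Preadditive.comp_neg, Category.comp_id, Preadditive.comp_neg, h]
        simp
      · have h' := Seq.cone_component_right F hF₆ n
        rw [← Seq.coneLast_eq] at h'
        rw [Category.assoc, Category.assoc, biprod.map_snd, Category.comp_id,
          Seq.biprodObjIso_snd, Iso.refl_hom, Category.comp_id]
        refine h'.trans ?_
        have h : X.seq.d (n + 1) = 0 := (X.seq.isZero (n + 2) (by omega)).eq_of_tgt _ _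
        simp only [g, h, zero_comp, add_zero, Category.assoc, Biprod.ofComponents_snd,
          biprod.lift_fst_assoc, biprod.lift_snd_assoc,
          Preadditive.comp_add, Preadditive.sub_comp]
        abel
    · refine .trans ?_ (Seq.lift_cone_zero.trans
        (Category.id_comp (Seq.biprodObjIso 1 (Iso.refl _) (Seq.trivOne _ n)).hom))
      exact congrArg (biprod.lift _) ((congrArg (_ - ·) comp_zero).trans (sub_zero _))
    -- Undoing the twist, the first differential is `(x, y) ↦ (d⁰ x, y - a x)`; pushing `ρ` forward
    -- along it gives the connecting morphism of the cone up to the sign on `S X⁰`.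
    · have h : (pl.inv ≫ (X.seq.biprod (Seq.trivLeft (Y.seq.obj 0) n)).d 0) ≫
          (Seq.biprodObjIso 1 (Iso.refl _) (Seq.trivOne _ n)).hom =
          (Biprod.unipotentUpper a).inv ≫ biprod.map (X.seq.d 0) (𝟙 _) := by
        rw [Category.assoc, Iso.inv_comp_eq, Iso.trans_hom, Category.assoc, Iso.hom_inv_id_assoc]
        refine Seq.biprod_hom_ext' ?_ ?_
        · rw [← Category.assoc, ← Seq.app_comm, Category.assoc, Seq.inl_biprodObjIso,
            ← Category.assoc (Seq.app (Seq.biprodInl _ _) 0), Seq.inl_biprodObjIso]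
          simp
        · rw [← Category.assoc, ← Seq.app_comm, Category.assoc, Seq.inr_biprodObjIso,
            ← Category.assoc (Seq.app (Seq.biprodInr _ _) 0), Seq.inr_biprodObjIso, Seq.trivLeft_d]
          simp
      rw [Category.assoc, ← S.map_comp, h]
      apply biprod.hom_ext'
      · simp only [ρ, biprod.inl_desc_assoc, ← S.map_comp, biprod.inl_map_assoc, biprod.inl_desc]
        have h' : biprod.inl ≫ (Biprod.unipotentUpper a).inv ≫ biprod.map (X.seq.d 0) (𝟙 _) =
            X.seq.d 0 ≫ biprod.inl - a ≫ biprod.inr := by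
          rw [Biprod.unipotentUpper_inv, ← Category.assoc, Biprod.inl_ofComponents]
          simp [sub_eq_add_neg]
        rw [h', S.map_sub]
        simp
        abel
      · have h' : biprod.inr ≫ (Biprod.unipotentUpper a).inv ≫ biprod.map (X.seq.d 0) (𝟙 _) =
            biprod.inr := by
          rw [Biprod.unipotentUpper_inv, ← Category.assoc, Biprod.inr_ofComponents]
          simp
        simp only [ρ, biprod.inr_desc_assoc, Category.assoc, ← S.map_comp, h']
        simp
  exact ⟨⟨Seq.homMk (fun i => match i with
    | 0 => a
    | i + 1 => g i) fun i => match i with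
      | 0 => (congrArg (_ ≫ ·) hb).trans hab
      | i + 1 => hg i, hg'.symm⟩, rfl, hb, key⟩

end Realization

end NExang

theorem mainTheorem4 {𝒞 : Type u} [CategoryTheory.Category.{v} 𝒞] [CategoryTheory.Preadditive 𝒞]
    [CategoryTheory.Limits.HasZeroObject 𝒞] [CategoryTheory.Limits.HasBinaryBiproducts 𝒞]
    (S : 𝒞 ⥤ 𝒞) [S.IsEquivalence] (n : ℕ) [NeZero n]
    (s : NExang.Realization (NExang.homShift S) n) (hs : s.IsExangulated) :
    NExang.IsAngulated S n s.angles := by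
  have := hs.isBiadditive.additive
  exact
    { mem_of_iso := hs.isExact.mem_angles_of_isIso
      biprod_mem_iff := fun X Y =>
        ⟨fun h => ⟨hs.isExact.left_mem_of_biprod_mem h, hs.isExact.right_mem_of_biprod_mem h⟩,
          fun h => hs.isExact.biprod_mem h.1 h.2⟩
      triv_mem := hs.isExact.triv_mem
      exists_first := hs.exists_first
      rotate_mem_iff := fun _ => ⟨hs.mem_of_rotate_mem, hs.rotate_mem⟩
      exists_hom := hs.exists_hom
      exists_hom_cone_mem := hs.exists_hom_cone_mem }
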